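/- **Setup.** Let $\beta,r_0>0$ be real and $D\ge 1$ an integer. Let $\Lambda\subset\mathbb Z^D$ be a finite lattice of $n$ sites with Euclidean distance $d$. Let $\mathcal H$ be a Hilbert space of dimension $2^n$ carrying self-adjoint Majorana operators $\gamma_1,\dots,\gamma_{2n}$, $\{\gamma_j,\gamma_k\}=2\delta_{jk}$, where $\gamma_{2a-1},\gamma_{2a}$ live on the $a$-th site. Let $H_0=\sum_{j,k}h_{jk}\gamma_j\gamma_k$ be self-adjoint and $(1,r_0)$-geometrically local, i.e. $H_0=\sum_{x\in\Lambda}W_x$ with $\|W_x\|\le 1$ and $W_x$ in the algebra generated by the Majorana operators on sites $y$ with $d(x,y)\le r_0$. Put $\gamma_j^{\rm free}(t)=e^{iH_0t}\gamma_je^{-iH_0t}$, $$f(t)=\frac{e^{-t^2/\beta^2}}{\sqrt{\beta\sqrt{\pi/2}}},\quad b_1(t)=2\sqrt\pi e^{1/8}\int_{\mathbb R}\frac{\sin(-(t-s))e^{-2(t-s)^2}}{\cosh(2\pi s)}\,ds,\quad b_2(t)=\frac{e^{-4t^2-2it}}{2\pi^{3/2}},\quad \eta(\omega)=e^{-(\beta\omega+1)^2/2},$$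 $$\tilde A_j(\omega)=e^{-\beta H_0/4}\Big(\tfrac1{\sqrt{2\pi}}\int\gamma_j^{\rm free}(t)f(t)e^{-i\omega t}dt\Big)e^{\beta H_0/4},$$ $$\tilde B_j=e^{-\beta H_0/4}\int dt\,b_1(t)\int dt'\,b_2(t')\,\gamma_j^{\rm free}(\beta(t'-t))\,\gamma_j^{\rm free}(-\beta(t+t'))\;e^{\beta H_0/4}.$$ Let $\mathcal H'$ have orthonormal basis $v_\alpha$, $\alpha\in\{0,1\}^{2n}$, and let $\varphi:B(\mathcal H)\to\mathcal H'$ be the linear bijection with $\varphi(\gamma^\alpha)=v_\alpha$, where $\gamma^\alpha=\gamma_1^{\alpha_1}\cdots\gamma_{2n}^{\alpha_{2n}}$. Let $\hat c_jv_\alpha=\delta_{1,\alpha_j}\varphi(\gamma_j\gamma^\alpha)$, $\hat c_j^\dagger v_\alpha=\delta_{0,\alpha_j}\varphi(\gamma_j\gamma^\alpha)$, $\hat\gamma_{2j-1}=\hat c_j+\hat c_j^\dagger$, $\hat\gamma_{2j}=i(\hat c_j^\dagger-\hat c_j)$ and $(-1)^{\hat n}v_\alpha=(-1)^{|\alpha|}v_\alpha$;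 thus $\hat\gamma_{4a-3},\dots,\hat\gamma_{4a}$ live on the $a$-th site. With $L_WX=WX$, $R_WX=XW$, let $\Phi$ be the linear map from super-operators on $B(\mathcal H)$ to $B(\mathcal H')$ such that $\Phi(L_WR_{W'})=(\varphi L_W\varphi^{-1})(\varphi R_{W'}\varphi^{-1})$ if $W'$ is even (a combination of $\gamma^\alpha$ with $|\alpha|$ even), and the same expression times $(-1)^{\hat n}$ on the right if $W'$ is odd. Define $$H_0^{\rm parent}=\Phi\Big(i\sum_j(L_{\tilde B_j}-R_{\tilde B_j^\dagger})\Big)+\Phi\Big(\sum_j\int d\omega\,\eta(\omega)\big(L_{\tilde A_j(-\omega)}R_{\tilde A_j(-\omega)^\dagger}-\tfrac12L_{\tilde A_j(-\omega)\tilde A_j(\omega)}-\tfrac12R_{\tilde A_j(\omega)^\dagger\tilde A_j(-\omega)^\dagger}\big)\Big).$$ **Proposition.** There are constants $K,\nu>0$ depending only on $\beta,r_0,D$ such that, for all $n$, $\Lambda$ and $H_0$ as above, $H_0^{\rm parent}=\sum_{j,k=1}^{4n}m_{jk}\hat\gamma_j\hat\gamma_k$ for a coefficient matrix $(m_{jk})$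 (normalized to be unique: $m_{kj}=-m_{jk}$ for $j\ne k$, and $m_{jj}$ independent of $j$) which has $[K,\nu]$-decay: for all $x,y\in\Lambda$, the block $m_{xy}$ of rows on site $x$ and columns on site $y$ satisfies, in operator norm, $$\|m_{xy}\|\le Ke^{-\nu d(x,y)}.$$ -/

import Mathlib

open scoped ComplexConjugate
open MeasureTheory

noncomputable section

namespace FreeParent

/-! ### Linear independence from sign characters -/

theorem linearIndependent_of_signs {A ι κ : Type*} [Fintype ι] [Ring A] [Algebra ℂ A]
    (tr : A →ₗ[ℂ] ℂ) (htr : ∀ x y, tr (x * y) = tr (y * x)) (h1 : tr 1 ≠ 0)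
    (e e' : ι → A) (he : ∀ i, e' i * e i = 1) (g : κ → A) (hg : ∀ k, g k * g k = 1)
    (s : κ → ι → ℂ) (hs : ∀ k i, g k * e i * g k = s k i • e i)
    (hs' : ∀ k i, g k * e' i * g k = s k i • e' i)
    (hsep : ∀ i j, i ≠ j → ∃ k, s k i * s k j ≠ 1) : LinearIndependent ℂ e := by
  classical
  have orth : ∀ i j, i ≠ j → tr (e' i * e j) = 0 := by
    intro i j hij
    obtain ⟨k, hk⟩ := hsep i j hij
    have h : tr (e' i * e j) = (s k i * s k j) * tr (e' i * e j) := by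
      have h2 : (g k * e' i * g k) * (g k * e j * g k) = g k * ((e' i * e j) * g k) := by
        have h3 : (g k * e' i * g k) * (g k * e j * g k)
            = g k * e' i * (g k * g k) * e j * g k := by noncomm_ring
        rw [h3, hg k]
        noncomm_ring
      have h4 : tr (g k * ((e' i * e j) * g k)) = tr (e' i * e j) := by
        rw [htr, mul_assoc, hg k, mul_one]
      rw [hs, hs', smul_mul_smul_comm] at h2
      rw [← h2, map_smul, smul_eq_mul] at h4
      exact h4.symm
    have h5 : (1 - s k i * s k j) * tr (e' i * e j) = 0 := by linear_combination h
    rcases mul_eq_zero.mp h5 with h6 | h6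
    · exact absurd (sub_eq_zero.mp h6).symm hk
    · exact h6
  rw [Fintype.linearIndependent_iff]
  intro c hc i
  have h : tr (e' i * ∑ j, c j • e j) = 0 := by rw [hc, mul_zero, map_zero]
  rw [Finset.mul_sum, map_sum, Finset.sum_eq_single i] at h
  · rw [mul_smul_comm, he, map_smul, smul_eq_mul] at h
    exact (mul_eq_zero.mp h).resolve_right h1
  · intro j _ hj
    rw [mul_smul_comm, map_smul, orth i j (Ne.symm hj), smul_zero]
  · simp

/-- The sign picked up by the monomial with exponents `α` under conjugation with the `k`-th
Majorana operator. -/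
def conjSign {N : ℕ} (k : Fin N) (α : Fin N → Fin 2) : ℂ :=
  ∏ j, (if j = k then (1 : ℂ) else -1) ^ (α j : ℕ)

theorem conjSign_sep {n : ℕ} (α α' : Fin (2 * n) → Fin 2) (h : α ≠ α') :
    ∃ k, conjSign k α * conjSign k α' ≠ 1 := by
  classical
  by_contra! hk
  apply h
  let δ : Fin (2 * n) → ℂ := fun j => (-1) ^ ((α j : ℕ) + (α' j : ℕ))
  have hδ2 : ∀ j, δ j * δ j = 1 := by
    intro j
    simp only [δ, ← mul_pow]
    norm_num
  have hprod : ∀ k, conjSign k α * conjSign k α' = (∏ j, δ j) * δ k := by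
    intro k
    have h1 : conjSign k α * conjSign k α'
        = ∏ j, (δ j * if j = k then δ k else 1) := by
      simp only [conjSign, ← Finset.prod_mul_distrib, ← pow_add]
      refine Finset.prod_congr rfl fun j _ => ?_
      by_cases hj : j = k
      · subst hj
        simp [hδ2]
      · simp [hj, δ]
    rw [h1, Finset.prod_mul_distrib, Finset.prod_ite_eq' Finset.univ k fun _ => δ k]
    simp
  have hall : ∀ k, δ k = ∏ j, δ j := by
    intro k
    have h1 := hprod k
    rw [hk k] at h1
    calc δ k = ((∏ j, δ j) * δ k) * δ k := by rw [← h1, one_mul]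
      _ = (∏ j, δ j) * (δ k * δ k) := by ring
      _ = _ := by rw [hδ2, mul_one]
  funext k
  have hone : (∏ j, δ j) = 1 := by
    have h1 : (∏ j, δ j) = ∏ _j : Fin (2 * n), δ k :=
      Finset.prod_congr rfl fun j _ => (hall j).trans (hall k).symm
    rw [h1, Finset.prod_const, Finset.card_univ, Fintype.card_fin, pow_mul, pow_two, hδ2, one_pow]
  have h2 : δ k = 1 := (hall k).trans hone
  simp only [δ] at h2
  generalize α k = a at h2 ⊢
  generalize α' k = b at h2 ⊢
  fin_cases a <;> fin_cases b <;> first | rfl | (exfalso; norm_num at h2)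

/-! ### Majorana operators -/

variable {n : ℕ} {ℋ : Type*} [NormedAddCommGroup ℋ] [InnerProductSpace ℂ ℋ]

/-- The Hilbert space `ℋ` of `n` Dirac fermion modes: it has dimension `2 ^ n` and carries `2 n`
self-adjoint Majorana operators with `{γ_j, γ_k} = 2 δ_{jk}`. -/
structure MajoranaSystem (n : ℕ) (ℋ : Type*) [NormedAddCommGroup ℋ] [InnerProductSpace ℂ ℋ]
    [CompleteSpace ℋ] where
  γ : Fin (2 * n) → (ℋ →L[ℂ] ℋ)
  isSelfAdjoint : ∀ j, IsSelfAdjoint (γ j)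
  anticomm : ∀ j k, γ j * γ k + γ k * γ j = if j = k then 2 else 0
  finrank_eq : Module.finrank ℂ ℋ = 2 ^ n

/-- The Hilbert space `ℋ'` of dimension `2 ^ (2 n)`. -/
abbrev EnlargedSpace (n : ℕ) : Type := EuclideanSpace ℂ (Fin (2 * n) → Fin 2)

/-- The orthonormal basis `v_α` of `ℋ'`. -/
def vBasis (n : ℕ) : Module.Basis (Fin (2 * n) → Fin 2) ℂ (EnlargedSpace n) :=
  (EuclideanSpace.basisFun (Fin (2 * n) → Fin 2) ℂ).toBasis

/-- Left multiplication `L_W X = W X`. -/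
def superL (W : ℋ →L[ℂ] ℋ) : (ℋ →L[ℂ] ℋ) →L[ℂ] (ℋ →L[ℂ] ℋ) :=
  ContinuousLinearMap.mul ℂ (ℋ →L[ℂ] ℋ) W

/-- Right multiplication `R_W X = X W`. -/
def superR (W : ℋ →L[ℂ] ℋ) : (ℋ →L[ℂ] ℋ) →L[ℂ] (ℋ →L[ℂ] ℋ) :=
  (ContinuousLinearMap.mul ℂ (ℋ →L[ℂ] ℋ)).flip W

@[simp] theorem superL_apply (W X : ℋ →L[ℂ] ℋ) : superL W X = W * X := rfl

@[simp] theorem superR_apply (W X : ℋ →L[ℂ] ℋ) : superR W X = X * W := rfl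

variable [CompleteSpace ℋ] [FiniteDimensional ℂ ℋ]

namespace MajoranaSystem

/-- The ordered Majorana monomial `γ_1^{α_1} γ_2^{α_2} ⋯ γ_{2n}^{α_{2n}}`. -/
def monomial (M : MajoranaSystem n ℋ) (α : Fin (2 * n) → Fin 2) : ℋ →L[ℂ] ℋ :=
  (List.ofFn fun j => M.γ j ^ (α j : ℕ)).prod

theorem γ_sq (M : MajoranaSystem n ℋ) (j : Fin (2 * n)) : M.γ j * M.γ j = 1 := by
  have h := M.anticomm j j
  rw [if_pos rfl, ← two_smul ℂ (M.γ j * M.γ j)] at h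
  have h2 : (2 : ℂ) • (M.γ j * M.γ j) = (2 : ℂ) • (1 : ℋ →L[ℂ] ℋ) := by
    rw [h, two_smul]; norm_num
  exact smul_right_injective _ (two_ne_zero) h2

theorem γ_conj (M : MajoranaSystem n ℋ) (k j : Fin (2 * n)) :
    M.γ k * M.γ j * M.γ k = (if j = k then (1 : ℂ) else -1) • M.γ j := by
  by_cases h : j = k
  · subst h
    rw [M.γ_sq, one_mul, if_pos rfl, one_smul]
  · have h1 := M.anticomm k j
    rw [if_neg (Ne.symm h)] at h1
    rw [eq_neg_of_add_eq_zero_left h1, neg_mul, mul_assoc, M.γ_sq, if_neg h, mul_one, neg_smul,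
      one_smul]

theorem list_conj {A : Type*} [Ring A] [Algebra ℂ A] (g : A) (hg : g * g = 1) :
    ∀ (m : ℕ) (x : Fin m → A) (c : Fin m → ℂ), (∀ j, g * x j * g = c j • x j) →
      g * (List.ofFn x).prod * g = (∏ j, c j) • (List.ofFn x).prod := by
  intro m
  induction m with
  | zero => intro x c _; simp [hg]
  | succ m ih =>
    intro x c h
    have h2 := ih (fun j => x j.succ) (fun j => c j.succ) (fun j => h j.succ)
    rw [List.ofFn_succ, List.prod_cons, Fin.prod_univ_succ]
    calc g * (x 0 * (List.ofFn fun j => x j.succ).prod) * g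
        = g * x 0 * (g * g) * (List.ofFn fun j => x j.succ).prod * g := by
          rw [hg]; noncomm_ring
      _ = (g * x 0 * g) * (g * (List.ofFn fun j => x j.succ).prod * g) := by noncomm_ring
      _ = _ := by rw [h 0, h2, smul_mul_smul_comm]

theorem monomial_conj (M : MajoranaSystem n ℋ) (k : Fin (2 * n)) (α : Fin (2 * n) → Fin 2) :
    M.γ k * M.monomial α * M.γ k = conjSign k α • M.monomial α := by
  refine list_conj (M.γ k) (M.γ_sq k) _ _ _ fun j => ?_
  generalize α j = a
  fin_cases a
  · simp [M.γ_sq]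
  · simpa using M.γ_conj k j

theorem conjSign_star {N : ℕ} (k : Fin N) (α : Fin N → Fin 2) :
    star (conjSign k α) = conjSign k α := by
  simp only [conjSign, star_prod, star_pow]
  refine Finset.prod_congr rfl fun j _ => ?_
  split_ifs <;> simp

theorem star_monomial_conj (M : MajoranaSystem n ℋ) (k : Fin (2 * n))
    (α : Fin (2 * n) → Fin 2) :
    M.γ k * star (M.monomial α) * M.γ k = conjSign k α • star (M.monomial α) := by
  have h := congrArg star (M.monomial_conj k α)
  rwa [star_mul, star_mul, star_smul, conjSign_star, (M.isSelfAdjoint k).star_eq,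
    ← mul_assoc] at h

theorem list_unitary {A : Type*} [Ring A] [StarRing A] :
    ∀ l : List A, (∀ x ∈ l, star x * x = 1 ∧ x * star x = 1) →
      star l.prod * l.prod = 1 ∧ l.prod * star l.prod = 1 := by
  intro l
  induction l with
  | nil => intro _; simp
  | cons a l ih =>
    intro h
    have h1 := h a (by simp)
    have h2 := ih fun x hx => h x (by simp [hx])
    rw [List.prod_cons, star_mul]
    constructor
    · calc star l.prod * star a * (a * l.prod) = star l.prod * (star a * a) * l.prod := by
            noncomm_ring
        _ = 1 := by rw [h1.1, mul_one, h2.1]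
    · calc a * l.prod * (star l.prod * star a) = a * (l.prod * star l.prod) * star a := by
            noncomm_ring
        _ = 1 := by rw [h2.2, mul_one, h1.2]

theorem monomial_unitary (M : MajoranaSystem n ℋ) (α : Fin (2 * n) → Fin 2) :
    star (M.monomial α) * M.monomial α = 1 ∧ M.monomial α * star (M.monomial α) = 1 := by
  refine list_unitary _ fun x hx => ?_
  obtain ⟨j, rfl⟩ := (List.mem_ofFn' _ _).mp hx
  rcases Nat.lt_succ_iff_lt_or_eq.mp (α j).isLt with h | h
  · simp [Nat.lt_one_iff.mp h]
  · simp [h, (M.isSelfAdjoint j).star_eq, M.γ_sq]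

theorem finrank_ops (M : MajoranaSystem n ℋ) :
    Module.finrank ℂ (ℋ →L[ℂ] ℋ) = 2 ^ (2 * n) := by
  rw [← (LinearMap.toContinuousLinearMap (𝕜 := ℂ) (E := ℋ) (F' := ℋ)).finrank_eq,
    Module.finrank_linearMap, M.finrank_eq, ← pow_add, two_mul]

/-- The trace on bounded operators of a finite-dimensional space. -/
def opTrace (E : Type*) [NormedAddCommGroup E] [NormedSpace ℂ E] : (E →L[ℂ] E) →ₗ[ℂ] ℂ :=
  (LinearMap.trace ℂ E).comp (ContinuousLinearMap.coeLM ℂ)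

theorem opTrace_comm (E : Type*) [NormedAddCommGroup E] [NormedSpace ℂ E]
    (x y : E →L[ℂ] E) : opTrace E (x * y) = opTrace E (y * x) :=
  LinearMap.trace_mul_comm ℂ (x : E →ₗ[ℂ] E) (y : E →ₗ[ℂ] E)

theorem opTrace_one (E : Type*) [NormedAddCommGroup E] [NormedSpace ℂ E]
    [FiniteDimensional ℂ E] : opTrace E 1 = Module.finrank ℂ E :=
  LinearMap.trace_one ℂ E

theorem monomial_linearIndependent (M : MajoranaSystem n ℋ) :
    LinearIndependent ℂ M.monomial := by
  refine linearIndependent_of_signs (opTrace ℋ) (opTrace_comm ℋ) ?_ M.monomial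
    (fun α => star (M.monomial α)) (fun α => (M.monomial_unitary α).1) M.γ M.γ_sq conjSign
    M.monomial_conj M.star_monomial_conj conjSign_sep
  rw [opTrace_one, M.finrank_eq]
  simp

/-- The Majorana monomials form a basis of `B(ℋ)`. -/
def monomialBasis (M : MajoranaSystem n ℋ) :
    Module.Basis (Fin (2 * n) → Fin 2) ℂ (ℋ →L[ℂ] ℋ) :=
  basisOfLinearIndependentOfCardEqFinrank M.monomial_linearIndependent
    (by rw [M.finrank_ops]; simp)

@[simp] theorem monomialBasis_apply (M : MajoranaSystem n ℋ) (α : Fin (2 * n) → Fin 2) :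
    M.monomialBasis α = M.monomial α := by
  simp [monomialBasis]

theorem super_linearIndependent (M : MajoranaSystem n ℋ) :
    LinearIndependent ℂ fun p : (Fin (2 * n) → Fin 2) × (Fin (2 * n) → Fin 2) =>
      superL (M.monomial p.1) * superR (M.monomial p.2) := by
  refine linearIndependent_of_signs (opTrace (ℋ →L[ℂ] ℋ)) (opTrace_comm _) ?_ _
    (fun p => superL (star (M.monomial p.1)) * superR (star (M.monomial p.2))) ?_
    (κ := Fin (2 * n) ⊕ Fin (2 * n))
    (Sum.elim (fun k => superL (M.γ k)) fun k => superR (M.γ k)) ?_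
    (Sum.elim (fun k p => conjSign k p.1) fun k p => conjSign k p.2) ?_ ?_ ?_
  · rw [opTrace_one, M.finrank_ops]
    simp
  · intro p
    ext1 X
    have h1 := (M.monomial_unitary p.1).1
    have h2 := (M.monomial_unitary p.2).2
    simp only [mul_apply_eq_comp, superL_apply, superR_apply,
      one_apply_eq_self]
    calc star (M.monomial p.1) * (M.monomial p.1 * (X * M.monomial p.2) * star (M.monomial p.2))
        = (star (M.monomial p.1) * M.monomial p.1) * X
          * (M.monomial p.2 * star (M.monomial p.2)) := by noncomm_ring
      _ = X := by rw [h1, h2, one_mul, mul_one]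
  · rintro (k | k)
    · ext1 X
      simp [← mul_assoc, M.γ_sq]
    · ext1 X
      simp [mul_assoc, M.γ_sq]
  · rintro (k | k) p
    · ext1 X
      simp only [Sum.elim_inl, mul_apply_eq_comp, superL_apply, superR_apply,
        ContinuousLinearMap.smul_apply]
      rw [← smul_mul_assoc, ← M.monomial_conj k p.1]
      noncomm_ring
    · ext1 X
      simp only [Sum.elim_inr, mul_apply_eq_comp, superL_apply, superR_apply,
        ContinuousLinearMap.smul_apply]
      rw [← mul_smul_comm, ← mul_smul_comm, ← M.monomial_conj k p.2]
      noncomm_ring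
  · rintro (k | k) p
    · ext1 X
      simp only [Sum.elim_inl, mul_apply_eq_comp, superL_apply, superR_apply,
        ContinuousLinearMap.smul_apply]
      rw [← smul_mul_assoc, ← M.star_monomial_conj k p.1]
      noncomm_ring
    · ext1 X
      simp only [Sum.elim_inr, mul_apply_eq_comp, superL_apply, superR_apply,
        ContinuousLinearMap.smul_apply]
      rw [← mul_smul_comm, ← mul_smul_comm, ← M.star_monomial_conj k p.2]
      noncomm_ring
  · rintro p q hpq
    by_cases h : p.1 = q.1
    · obtain ⟨k, hk⟩ := conjSign_sep p.2 q.2 fun h2 => hpq (Prod.ext h h2)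
      exact ⟨Sum.inr k, hk⟩
    · obtain ⟨k, hk⟩ := conjSign_sep p.1 q.1 h
      exact ⟨Sum.inl k, hk⟩

/-- The super-operators `L_{γ^α} R_{γ^α'}` form a basis of `B(B(ℋ))`. -/
def superBasis (M : MajoranaSystem n ℋ) :
    Module.Basis ((Fin (2 * n) → Fin 2) × (Fin (2 * n) → Fin 2)) ℂ
      ((ℋ →L[ℂ] ℋ) →L[ℂ] (ℋ →L[ℂ] ℋ)) :=
  basisOfLinearIndependentOfCardEqFinrank M.super_linearIndependent (by
    rw [← (LinearMap.toContinuousLinearMap (𝕜 := ℂ) (E := ℋ →L[ℂ] ℋ)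
      (F' := ℋ →L[ℂ] ℋ)).finrank_eq, Module.finrank_linearMap, M.finrank_ops]
    simp)

@[simp] theorem superBasis_apply (M : MajoranaSystem n ℋ)
    (p : (Fin (2 * n) → Fin 2) × (Fin (2 * n) → Fin 2)) :
    M.superBasis p = superL (M.monomial p.1) * superR (M.monomial p.2) := by
  simp [superBasis]

/-! ### Third quantization -/

/-- The map `φ : B(ℋ) → ℋ'` with `φ(γ^α) = v_α`. -/
def phi (M : MajoranaSystem n ℋ) : (ℋ →L[ℂ] ℋ) ≃ₗ[ℂ] EnlargedSpace n :=
  M.monomialBasis.equiv (vBasis n) (Equiv.refl _)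

@[simp] theorem phi_monomial (M : MajoranaSystem n ℋ) (α : Fin (2 * n) → Fin 2) :
    M.phi (M.monomial α) = vBasis n α := by
  rw [← M.monomialBasis_apply, phi, Module.Basis.equiv_apply, Equiv.refl_apply]

/-- The operator `φ ∘ 𝒳 ∘ φ⁻¹` on `ℋ'`. -/
def rep (M : MajoranaSystem n ℋ) (𝒳 : (ℋ →L[ℂ] ℋ) →L[ℂ] (ℋ →L[ℂ] ℋ)) :
    EnlargedSpace n →L[ℂ] EnlargedSpace n :=
  LinearMap.toContinuousLinearMap
    (M.phi.toLinearMap ∘ₗ (𝒳 : (ℋ →L[ℂ] ℋ) →ₗ[ℂ] (ℋ →L[ℂ] ℋ)) ∘ₗ M.phi.symm.toLinearMap)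

/-- The annihilation operator `ĉ_j v_α = δ_{1,α_j} φ(γ_j γ^α)`. -/
def cHat (M : MajoranaSystem n ℋ) (j : Fin (2 * n)) : EnlargedSpace n →L[ℂ] EnlargedSpace n :=
  LinearMap.toContinuousLinearMap
    ((vBasis n).constr ℂ fun α => if α j = 1 then M.phi (M.γ j * M.monomial α) else 0)

/-- The creation operator `ĉ_j† v_α = δ_{0,α_j} φ(γ_j γ^α)`. -/
def cHatDag (M : MajoranaSystem n ℋ) (j : Fin (2 * n)) :
    EnlargedSpace n →L[ℂ] EnlargedSpace n :=
  LinearMap.toContinuousLinearMap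
    ((vBasis n).constr ℂ fun α => if α j = 0 then M.phi (M.γ j * M.monomial α) else 0)

/-- The Majorana operators on `ℋ'`. With indices starting from `0`,
`γ̂_{2j} = ĉ_j + ĉ_j†` and `γ̂_{2j+1} = i (ĉ_j† - ĉ_j)`. -/
def gammaHat (M : MajoranaSystem n ℋ) (l : Fin (4 * n)) :
    EnlargedSpace n →L[ℂ] EnlargedSpace n :=
  let j : Fin (2 * n) := ⟨l / 2, by omega⟩
  if (l : ℕ) % 2 = 0 then M.cHat j + M.cHatDag j
  else Complex.I • (M.cHatDag j - M.cHat j)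

end MajoranaSystem

/-- The parity operator `(-1)^{n̂}` on `ℋ'`: `v_α ↦ (-1)^{|α|} v_α`. -/
def parityHat (n : ℕ) : EnlargedSpace n →L[ℂ] EnlargedSpace n :=
  LinearMap.toContinuousLinearMap
    ((vBasis n).constr ℂ fun α => ((-1 : ℂ) ^ ∑ j, (α j : ℕ)) • vBasis n α)

namespace MajoranaSystem

/-- `B(ℋ)_even`: the span of the Majorana monomials of even degree. -/
def evenOps (M : MajoranaSystem n ℋ) : Submodule ℂ (ℋ →L[ℂ] ℋ) :=
  Submodule.span ℂ (M.monomial '' {α | Even (∑ j, (α j : ℕ))})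

/-- `B(ℋ)_odd`: the span of the Majorana monomials of odd degree. -/
def oddOps (M : MajoranaSystem n ℋ) : Submodule ℂ (ℋ →L[ℂ] ℋ) :=
  Submodule.span ℂ (M.monomial '' {α | Odd (∑ j, (α j : ℕ))})

/-- The third quantization map `Φ : B(B(ℋ)) → B(ℋ')`: the linear map with
`Φ(L_W R_W') = (φ L_W φ⁻¹) (φ R_W' φ⁻¹)` for even `W'` and
`Φ(L_W R_W') = (φ L_W φ⁻¹) (φ R_W' φ⁻¹) (-1)^{n̂}` for odd `W'`
(see `Phi_even` and `Phi_odd` below). -/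
def Phi (M : MajoranaSystem n ℋ) :
    ((ℋ →L[ℂ] ℋ) →L[ℂ] (ℋ →L[ℂ] ℋ)) →ₗ[ℂ] (EnlargedSpace n →L[ℂ] EnlargedSpace n) :=
  M.superBasis.constr ℂ fun p =>
    M.rep (superL (M.monomial p.1)) * (M.rep (superR (M.monomial p.2)) *
      if Even (∑ j, (p.2 j : ℕ)) then 1 else parityHat n)

theorem rep_superL_lin (M : MajoranaSystem n ℋ) :
    ∃ f : (ℋ →L[ℂ] ℋ) →ₗ[ℂ] (EnlargedSpace n →L[ℂ] EnlargedSpace n),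
      ∀ W, f W = M.rep (superL W) :=
  ⟨{ toFun := fun W => M.rep (superL W)
     map_add' := fun x y => by ext1 v; simp [rep, add_mul]
     map_smul' := fun c x => by ext1 v; simp [rep] }, fun _ => rfl⟩

theorem rep_superR_lin (M : MajoranaSystem n ℋ) :
    ∃ f : (ℋ →L[ℂ] ℋ) →ₗ[ℂ] (EnlargedSpace n →L[ℂ] EnlargedSpace n),
      ∀ W, f W = M.rep (superR W) :=
  ⟨{ toFun := fun W => M.rep (superR W)
     map_add' := fun x y => by ext1 v; simp [rep, mul_add]
     map_smul' := fun c x => by ext1 v; simp [rep] }, fun _ => rfl⟩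

theorem Phi_monomial_right (M : MajoranaSystem n ℋ) (W : ℋ →L[ℂ] ℋ)
    (α : Fin (2 * n) → Fin 2) :
    M.Phi (superL W * superR (M.monomial α)) =
      M.rep (superL W) * (M.rep (superR (M.monomial α)) *
        if Even (∑ j, (α j : ℕ)) then 1 else parityHat n) := by
  obtain ⟨f, hf⟩ := M.rep_superL_lin
  have hsm : ∀ (c : ℂ) (x y : ℋ →L[ℂ] ℋ), superL (c • x) * superR y = c • (superL x * superR y) :=
    fun c x y => by ext1 X; simp
  have hadd : ∀ x y : ℋ →L[ℂ] ℋ, superL (x + y) = superL x + superL y := fun x y => map_add _ x y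
  rw [← hf]
  have hW : W ∈ Submodule.span ℂ (Set.range M.monomialBasis) := by
    rw [M.monomialBasis.span_eq]; trivial
  induction hW using Submodule.span_induction with
  | mem x hx =>
    obtain ⟨α', rfl⟩ := hx
    have h2 := M.superBasis.constr_basis ℂ (fun p => M.rep (superL (M.monomial p.1)) *
      (M.rep (superR (M.monomial p.2)) *
        if Even (∑ j, (p.2 j : ℕ)) then 1 else parityHat n)) (α', α)
    rw [superBasis_apply] at h2
    rw [hf, monomialBasis_apply]
    exact h2
  | zero =>
    have h0 : superL (0 : ℋ →L[ℂ] ℋ) = 0 := map_zero _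
    rw [h0, zero_mul, map_zero, map_zero, zero_mul]
  | add x y _ _ hx hy => rw [hadd, add_mul, map_add, hx, hy, map_add, add_mul]
  | smul c x _ hx => rw [hsm, map_smul, hx, map_smul, smul_mul_assoc]

theorem Phi_even (M : MajoranaSystem n ℋ) (W W' : ℋ →L[ℂ] ℋ) (hW : W' ∈ M.evenOps) :
    M.Phi (superL W * superR W') = M.rep (superL W) * M.rep (superR W') := by
  obtain ⟨f, hf⟩ := M.rep_superR_lin
  have hadd : ∀ x y : ℋ →L[ℂ] ℋ, superR (x + y) = superR x + superR y := fun x y => map_add _ x y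
  have hsm : ∀ (c : ℂ) (x : ℋ →L[ℂ] ℋ), superL W * superR (c • x) = c • (superL W * superR x) :=
    fun c x => by ext1 X; simp
  rw [← hf]
  induction hW using Submodule.span_induction with
  | mem x hx =>
    obtain ⟨α, hα, rfl⟩ := hx
    rw [Phi_monomial_right, hf, if_pos (show Even (∑ j, (α j : ℕ)) from hα), mul_one]
  | zero =>
    have h0 : superR (0 : ℋ →L[ℂ] ℋ) = 0 := map_zero _
    rw [h0, mul_zero, map_zero, map_zero, mul_zero]
  | add x y _ _ hx hy => rw [hadd, mul_add, map_add, hx, hy, map_add, mul_add]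
  | smul c x _ hx => rw [hsm, map_smul, hx, map_smul, mul_smul_comm]

theorem Phi_odd (M : MajoranaSystem n ℋ) (W W' : ℋ →L[ℂ] ℋ) (hW : W' ∈ M.oddOps) :
    M.Phi (superL W * superR W') =
      M.rep (superL W) * (M.rep (superR W') * parityHat n) := by
  obtain ⟨f, hf⟩ := M.rep_superR_lin
  have hadd : ∀ x y : ℋ →L[ℂ] ℋ, superR (x + y) = superR x + superR y := fun x y => map_add _ x y
  have hsm : ∀ (c : ℂ) (x : ℋ →L[ℂ] ℋ), superL W * superR (c • x) = c • (superL W * superR x) :=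
    fun c x => by ext1 X; simp
  rw [← hf]
  induction hW using Submodule.span_induction with
  | mem x hx =>
    obtain ⟨α, hα, rfl⟩ := hx
    rw [Phi_monomial_right, hf, if_neg (Nat.not_even_iff_odd.mpr hα)]
  | zero =>
    have h0 : superR (0 : ℋ →L[ℂ] ℋ) = 0 := map_zero _
    rw [h0, mul_zero, map_zero, map_zero, zero_mul, mul_zero]
  | add x y _ _ hx hy => rw [hadd, mul_add, map_add, hx, hy, map_add, add_mul, mul_add]
  | smul c x _ hx =>
    rw [hsm, map_smul, hx, map_smul, smul_mul_assoc, mul_smul_comm]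

end MajoranaSystem

/-! ### The free part of the parent Hamiltonian -/

/-- The filter function `f(t) = (β √(π/2))^{-1/2} e^{-t²/β²}`. -/
def filterF (β t : ℝ) : ℝ :=
  1 / √(β * √(Real.pi / 2)) * Real.exp (-t ^ 2 / β ^ 2)

/-- `b₁(t) = 2 √π e^{1/8} (1 / cosh(2πt) * sin(-t) e^{-2t²})`, with `*` the convolution in `t`. -/
def b₁ (t : ℝ) : ℝ :=
  2 * √Real.pi * Real.exp (1 / 8) *
    ∫ s : ℝ, 1 / Real.cosh (2 * Real.pi * s) *
      (Real.sin (-(t - s)) * Real.exp (-2 * (t - s) ^ 2))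

/-- `b₂(t) = (2 π^{3/2})⁻¹ e^{-4t² - 2it}`. -/
def b₂ (t : ℝ) : ℂ :=
  1 / (2 * (Real.pi ^ (3 / 2 : ℝ) : ℝ)) * Complex.exp (-4 * (t : ℂ) ^ 2 - 2 * Complex.I * t)

/-- `η(ω) = e^{-(βω+1)²/2}`. -/
def etaW (β ω : ℝ) : ℝ := Real.exp (-(β * ω + 1) ^ 2 / 2)

namespace MajoranaSystem

/-- The quadratic operator `∑_{jk} h_{jk} γ_j γ_k`. -/
def quadratic (M : MajoranaSystem n ℋ) (h : Matrix (Fin (2 * n)) (Fin (2 * n)) ℂ) :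
    ℋ →L[ℂ] ℋ :=
  ∑ j, ∑ k, h j k • (M.γ j * M.γ k)

/-- `γ_j^free(t) = e^{i H₀ t} γ_j e^{-i H₀ t}`. -/
def gammaFree (M : MajoranaSystem n ℋ) (H₀ : ℋ →L[ℂ] ℋ) (j : Fin (2 * n)) (t : ℝ) :
    ℋ →L[ℂ] ℋ :=
  NormedSpace.exp ((Complex.I * t) • H₀) * M.γ j * NormedSpace.exp ((-(Complex.I * t)) • H₀)

/-- The transformed free jump operators `Ã_j^free(ω)`. -/
def jumpFree (M : MajoranaSystem n ℋ) (β : ℝ) (H₀ : ℋ →L[ℂ] ℋ) (j : Fin (2 * n)) (ω : ℝ) :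
    ℋ →L[ℂ] ℋ :=
  NormedSpace.exp ((-(β / 4 : ℝ) : ℂ) • H₀) *
    ((1 / (√(2 * Real.pi) : ℝ) : ℂ) •
      ∫ t : ℝ, ((filterF β t : ℂ) * Complex.exp (-(Complex.I * ω * t))) • M.gammaFree H₀ j t) *
    NormedSpace.exp (((β / 4 : ℝ) : ℂ) • H₀)

/-- The transformed free coherent terms `B̃_j^free`. -/
def coherentFree (M : MajoranaSystem n ℋ) (β : ℝ) (H₀ : ℋ →L[ℂ] ℋ) (j : Fin (2 * n)) :
    ℋ →L[ℂ] ℋ :=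
  NormedSpace.exp ((-(β / 4 : ℝ) : ℂ) • H₀) *
    (∫ t : ℝ, (b₁ t : ℂ) • ∫ t' : ℝ, b₂ t' •
      (M.gammaFree H₀ j (β * (t' - t)) * M.gammaFree H₀ j (-β * (t + t')))) *
    NormedSpace.exp (((β / 4 : ℝ) : ℂ) • H₀)

/-- `H_{C,free}^parent = Φ(i ∑_j (L_{B̃_j} - R_{B̃_j†}))`. -/
def parentCoherentFree (M : MajoranaSystem n ℋ) (β : ℝ) (H₀ : ℋ →L[ℂ] ℋ) :
    EnlargedSpace n →L[ℂ] EnlargedSpace n :=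
  M.Phi (Complex.I • ∑ j,
    (superL (M.coherentFree β H₀ j) - superR (star (M.coherentFree β H₀ j))))

/-- `H_{D,free}^parent = Φ(∑_j ∫ dω η(ω) (L_{Ã_j(-ω)} R_{Ã_j(-ω)†} - ½ L_{Ã_j(-ω) Ã_j(ω)}
- ½ R_{Ã_j(ω)† Ã_j(-ω)†}))`. -/
def parentDissipativeFree (M : MajoranaSystem n ℋ) (β : ℝ) (H₀ : ℋ →L[ℂ] ℋ) :
    EnlargedSpace n →L[ℂ] EnlargedSpace n :=
  M.Phi (∑ j, ∫ ω : ℝ, (etaW β ω : ℂ) •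
    (superL (M.jumpFree β H₀ j (-ω)) * superR (star (M.jumpFree β H₀ j (-ω)))
      - (1 / 2 : ℂ) • superL (M.jumpFree β H₀ j (-ω) * M.jumpFree β H₀ j ω)
      - (1 / 2 : ℂ) •
        superR (star (M.jumpFree β H₀ j ω) * star (M.jumpFree β H₀ j (-ω)))))

/-- The non-interacting part `H₀^parent` of the parent Hamiltonian. -/
def parentFree (M : MajoranaSystem n ℋ) (β : ℝ) (H₀ : ℋ →L[ℂ] ℋ) :
    EnlargedSpace n →L[ℂ] EnlargedSpace n :=
  M.parentCoherentFree β H₀ + M.parentDissipativeFree β H₀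

end MajoranaSystem

/-! ### Geometry and decay -/

/-- Euclidean distance on the cubic lattice `ℤ^D`. -/
def latticeDist {D : ℕ} (x y : Fin D → ℤ) : ℝ :=
  √(∑ i, ((x i : ℝ) - (y i : ℝ)) ^ 2)

/-- The index of the site carrying the Majorana mode `j`; two modes per site. -/
def modeSite {n : ℕ} (j : Fin (2 * n)) : Fin n := ⟨j / 2, by omega⟩

/-- The index of the site carrying the Majorana mode `l` of `ℋ'`; four modes per site. -/
def modeSite' {n : ℕ} (l : Fin (4 * n)) : Fin n := ⟨l / 4, by omega⟩

/-- `W` is supported on the set `S` of sites: it belongs to the algebra generated by the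
Majorana operators on the sites of `S`. -/
def MajoranaSystem.IsSupportedOn (M : MajoranaSystem n ℋ) (S : Set (Fin n))
    (W : ℋ →L[ℂ] ℋ) : Prop :=
  W ∈ Algebra.adjoin ℂ (M.γ '' {j | modeSite j ∈ S})

/-- `W` is `(ξ, r)`-geometrically local: it is a sum, over the balls of radius `r` centred at the
lattice sites, of operators supported on the balls and of norm at most `ξ`.
The `a`-th site of the lattice is `site a`. -/
def MajoranaSystem.IsGeometricallyLocal (M : MajoranaSystem n ℋ) {D : ℕ}
    (site : Fin n ↪ (Fin D → ℤ)) (ξ r : ℝ) (W : ℋ →L[ℂ] ℋ) : Prop :=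
  ∃ w : Fin n → (ℋ →L[ℂ] ℋ), W = ∑ a, w a ∧ ∀ a,
    M.IsSupportedOn {b | latticeDist (site a) (site b) ≤ r} (w a) ∧ ‖w a‖ ≤ ξ

/-- The operator norm (for Euclidean norms) of a rectangular complex matrix. -/
def matrixOpNorm {p q : Type*} [Fintype p] [Fintype q] [DecidableEq q] (A : Matrix p q ℂ) : ℝ :=
  ‖LinearMap.toContinuousLinearMap (Matrix.toEuclideanLin A)‖

/-- `[K, ν]`-decay of a matrix whose row and column indices `j` live on the sites `site (𝔰 j)`:
each block `A_{xy}` satisfies `‖A_{xy}‖ ≤ K e^{-ν d(x,y)}`. -/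
def HasBlockDecay {ι : Type*} [Fintype ι] [DecidableEq ι] {n D : ℕ} (site : Fin n ↪ (Fin D → ℤ))
    (𝔰 : ι → Fin n) (K ν : ℝ) (A : Matrix ι ι ℂ) : Prop :=
  ∀ x y : Fin n,
    matrixOpNorm (A.submatrix (fun j : {j // 𝔰 j = x} => j.1) (fun k : {k // 𝔰 k = y} => k.1))
      ≤ K * Real.exp (-ν * latticeDist (site x) (site y))

/-- `m` is the coefficient matrix of `W` as a quadratic form in the Majorana operators of `ℋ'`:
`W = ∑_{jk} m_{jk} γ̂_j γ̂_k`. The relations `γ̂_j γ̂_k = -γ̂_k γ̂_j` (`j ≠ k`) and `γ̂_j² = 1` leave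
freedom in `m`; it is removed by asking `m` to be antisymmetric off the diagonal and constant on
the diagonal. -/
def MajoranaSystem.IsCoefficientMatrix (M : MajoranaSystem n ℋ)
    (m : Matrix (Fin (4 * n)) (Fin (4 * n)) ℂ)
    (W : EnlargedSpace n →L[ℂ] EnlargedSpace n) : Prop :=
  W = ∑ j, ∑ k, m j k • (M.gammaHat j * M.gammaHat k) ∧
    (∀ j k, j ≠ k → m k j = -m j k) ∧ ∀ j k, m j j = m k k

end FreeParent

end

/-! # Decay of the free part of the parent Hamiltonian -/

noncomputable section

namespace FreeParent

/-! ### Lattice geometry -/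

/-! Everything reduces to single-particle matrices. The commutator of H₀ with a Majorana operator is
again linear, [H₀, γ_l] = ∑_k T_{kl} γ_k with T = 2(h − hᵀ), so real or imaginary time evolution
acts on the modes through exp(zT) (`exp_conj_γ`). Pairing with γ_l γ_k under the trace shows that
T_{kl} sees only those local terms whose ball contains both sites. Hence the row sums of T weighted
by e^d are bounded independently of n (`sum_norm_generator_le`), and a Combes–Thomas conjugation
carries this over to exp(zT) at the price of a factor e^{c‖z‖} (`sum_norm_exp_le`).

The coherent part vanishes identically. Since T is antisymmetric, ∑_j γ_j(s) γ_j(t) depends on s − t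
only; in the coherent term this difference is 2βt', so the outer integral factors out ∫ b₁, which is
zero because b₁ is odd (`sum_coherentFree`).

In the dissipative part each jump operator is a linear form in the γ_k whose coefficients average
exp((−β/4 + it)T) against a Gaussian, and the Gaussian beats the growth e^{c|t|}. Products of two
such coefficients, summed over the jump label and integrated against η, decay exponentially by the
triangle inequality (`norm_etaPairing_le`).

Under third quantization, left multiplication by γ_k is an even-indexed Majorana mode of ℋ', and
right multiplication by γ_k followed by the parity sign is, up to a factor i, an odd-indexed one. So
Φ sends the bilinear super-operators to quadratic forms in the γ̂. Antisymmetrizing the coefficients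
and averaging the diagonal preserves the entrywise bound, and blocks have size at most 4 × 4, so
entrywise decay is block decay. -/

theorem latticeDist_eq_dist {D : ℕ} (x y : Fin D → ℤ) :
    latticeDist x y = dist (WithLp.toLp 2 fun i => (x i : ℝ) : EuclideanSpace ℝ (Fin D))
      (WithLp.toLp 2 fun i => (y i : ℝ)) := by
  rw [latticeDist, EuclideanSpace.dist_eq]
  simp [Real.dist_eq, sq_abs]

theorem latticeDist_nonneg {D : ℕ} (x y : Fin D → ℤ) : 0 ≤ latticeDist x y :=
  Real.sqrt_nonneg _

theorem latticeDist_self {D : ℕ} (x : Fin D → ℤ) : latticeDist x x = 0 := by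
  simp [latticeDist]

theorem latticeDist_comm {D : ℕ} (x y : Fin D → ℤ) : latticeDist x y = latticeDist y x := by
  rw [latticeDist_eq_dist, latticeDist_eq_dist, dist_comm]

theorem latticeDist_triangle {D : ℕ} (x y z : Fin D → ℤ) :
    latticeDist x z ≤ latticeDist x y + latticeDist y z := by
  simp only [latticeDist_eq_dist]
  exact dist_triangle _ _ _

theorem abs_sub_le_latticeDist {D : ℕ} (x y : Fin D → ℤ) (i : Fin D) :
    |(x i : ℝ) - y i| ≤ latticeDist x y := by
  rw [← Real.sqrt_sq_eq_abs]
  exact Real.sqrt_le_sqrt (Finset.single_le_sum (f := fun i => ((x i : ℝ) - y i) ^ 2)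
    (fun i _ => sq_nonneg _) (Finset.mem_univ i))

/-- An upper bound on the number of lattice points in a ball of radius `r`. -/
def ballCount (D : ℕ) (r : ℝ) : ℕ := (2 * ⌈r⌉₊ + 1) ^ D

/-- Each coordinate difference is at most the Euclidean distance, so `site b - site a` lands
injectively in an integer cube of side 2⌈r⌉ + 1. -/
theorem card_ball_le {n D : ℕ} (site : Fin n ↪ (Fin D → ℤ)) (r : ℝ) (a : Fin n) :
    (Finset.univ.filter fun b => latticeDist (site a) (site b) ≤ r).card ≤ ballCount D r := by
  classical
  have hcard : (Fintype.piFinset fun _ : Fin D =>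
      Finset.Icc (-(⌈r⌉₊ : ℤ)) ⌈r⌉₊).card = ballCount D r := by
    rw [Fintype.card_piFinset, Finset.prod_const, Finset.card_univ, Fintype.card_fin,
      Int.card_Icc, ballCount]
    congr 1
    omega
  rw [← hcard]
  refine Finset.card_le_card_of_injOn (fun b => site b - site a) ?_ ?_
  · intro b hb
    rw [Finset.coe_filter, Set.mem_ofPred_eq] at hb
    rw [Finset.mem_coe, Fintype.mem_piFinset]
    intro i
    have h1 := (abs_sub_le_latticeDist (site a) (site b) i).trans (hb.2.trans (Nat.le_ceil r))
    have h2 : |site a i - site b i| ≤ (⌈r⌉₊ : ℤ) := by exact_mod_cast h1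
    rw [abs_le] at h2
    simp only [Finset.mem_Icc, Pi.sub_apply]
    omega
  · intro b _ c _ hbc
    exact site.injective (sub_left_injective hbc)

theorem card_modes_le {n : ℕ} (S : Finset (Fin n)) :
    (Finset.univ.filter fun j : Fin (2 * n) => modeSite j ∈ S).card ≤ 2 * S.card := by
  classical
  refine Finset.card_le_mul_card_image_of_maps_to (f := modeSite) (by simp) 2 fun a _ => ?_
  conv_rhs => rw [show 2 = (Finset.range 2).card from (Finset.card_range 2).symm]
  refine Finset.card_le_card_of_injOn (fun j => (j : ℕ) % 2) ?_ ?_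
  · intro j _
    simpa using Nat.le_of_lt_succ (Nat.mod_lt (j : ℕ) two_pos)
  · intro j hj k hk hjk
    simp only [Finset.coe_filter, Set.mem_ofPred_eq, modeSite, Fin.ext_iff] at hj hk hjk ⊢
    omega

/-! ### The single-particle generator -/

variable {n : ℕ} {ℋ : Type*} [NormedAddCommGroup ℋ] [InnerProductSpace ℂ ℋ]
  [CompleteSpace ℋ] [FiniteDimensional ℂ ℋ]

namespace MajoranaSystem

/-- Sums the 2^n diagonal matrix elements in an orthonormal basis. The dimension factor cancels
against the one in `generator_eq_trace`, which keeps the entries of T bounded uniformly in n. -/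
theorem norm_opTrace_le (M : MajoranaSystem n ℋ) (X : ℋ →L[ℂ] ℋ) :
    ‖opTrace ℋ X‖ ≤ 2 ^ n * ‖X‖ := by
  have h := LinearMap.trace_eq_sum_inner (X : ℋ →ₗ[ℂ] ℋ) (stdOrthonormalBasis ℂ ℋ)
  have h2 : opTrace ℋ X = LinearMap.trace ℂ ℋ (X : ℋ →ₗ[ℂ] ℋ) := rfl
  rw [h2, h]
  refine (norm_sum_le_of_le _ (f := fun i => inner ℂ _ _) (n := fun _ => ‖X‖) fun i _ => ?_).trans ?_
  · refine (norm_inner_le_norm _ _).trans ?_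
    have h3 := X.le_opNorm (stdOrthonormalBasis ℂ ℋ i)
    simpa using h3
  · rw [Finset.sum_const, Finset.card_univ, Fintype.card_fin, M.finrank_eq]
    simp

theorem nontrivial_space (M : MajoranaSystem n ℋ) : Nontrivial ℋ :=
  Module.nontrivial_of_finrank_pos (R := ℂ) (by rw [M.finrank_eq]; positivity)

theorem norm_γ_le (M : MajoranaSystem n ℋ) (j : Fin (2 * n)) : ‖M.γ j‖ ≤ 1 := by
  have := M.nontrivial_space
  refine (CStarRing.norm_of_mem_unitary (U := M.γ j) ?_).le
  rw [Unitary.mem_iff, (M.isSelfAdjoint j).star_eq, M.γ_sq]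
  exact ⟨rfl, rfl⟩

theorem anticomm_of_ne (M : MajoranaSystem n ℋ) {j k : Fin (2 * n)} (h : j ≠ k) :
    M.γ j * M.γ k = -(M.γ k * M.γ j) := by
  have h1 := M.anticomm j k
  rw [if_neg h] at h1
  exact eq_neg_of_add_eq_zero_left h1

theorem opTrace_γ_mul (M : MajoranaSystem n ℋ) (j k : Fin (2 * n)) :
    opTrace ℋ (M.γ j * M.γ k) = if j = k then 2 ^ n else 0 := by
  split_ifs with h
  · rw [h, M.γ_sq, opTrace_one, M.finrank_eq]
    simp
  · have h1 := congrArg (opTrace ℋ) (M.anticomm_of_ne h)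
    rw [map_neg, opTrace_comm ℋ (M.γ k)] at h1
    exact self_eq_neg.mp h1

/-- The matrix `T` with `[H₀, γ_l] = ∑_k T_{kl} γ_k`. -/
def generator (h : Matrix (Fin (2 * n)) (Fin (2 * n)) ℂ) : Matrix (Fin (2 * n)) (Fin (2 * n)) ℂ :=
  (2 : ℂ) • (h - h.transpose)

theorem generator_transpose (h : Matrix (Fin (2 * n)) (Fin (2 * n)) ℂ) :
    (generator h).transpose = -generator h := by
  simp [generator, smul_sub]

/-- Moving γ_l across γ_j γ_k takes two anticommutations; the cubic terms cancel and only the two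
contractions remain. The symmetric part of h drops out. -/
theorem quadratic_commutator (M : MajoranaSystem n ℋ) (h : Matrix (Fin (2 * n)) (Fin (2 * n)) ℂ)
    (l : Fin (2 * n)) :
    M.quadratic h * M.γ l - M.γ l * M.quadratic h = ∑ k, generator h k l • M.γ k := by
  have key : ∀ j k, M.γ j * M.γ k * M.γ l - M.γ l * (M.γ j * M.γ k)
      = (if k = l then (2 : ℂ) else 0) • M.γ j - (if j = l then (2 : ℂ) else 0) • M.γ k := by
    intro j k
    have hc : ∀ a b, M.γ a * M.γ b = (if a = b then (2 : ℂ) else 0) • (1 : ℋ →L[ℂ] ℋ)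
        - M.γ b * M.γ a := by
      intro a b
      rw [eq_sub_iff_add_eq, M.anticomm]
      split_ifs
      · rw [two_smul]; norm_num
      · simp
    rw [mul_assoc, hc k l, mul_sub, mul_smul_comm, mul_one, ← mul_assoc (M.γ l), hc l j, sub_mul,
      smul_mul_assoc, one_mul]
    simp only [eq_comm (a := l)]
    noncomm_ring
  simp only [quadratic, Finset.sum_mul, Finset.mul_sum, ← Finset.sum_sub_distrib, smul_mul_assoc,
    mul_smul_comm, ← smul_sub, key]
  simp only [smul_sub, Finset.sum_sub_distrib, ite_smul, zero_smul, smul_ite, smul_zero, smul_smul]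
  rw [Finset.sum_comm (f := fun x y => if x = l then (h x y * 2) • M.γ y else 0)]
  simp only [Finset.sum_ite_eq', Finset.mem_univ, if_true, ← Finset.sum_sub_distrib, ← sub_smul]
  refine Finset.sum_congr rfl fun k _ => ?_
  congr 1
  simp [generator]
  ring

/-- The Majorana operators are trace-orthogonal, so multiplying the commutator by γ_k and tracing
isolates one coefficient. By cyclicity and anticommutation (this needs k ≠ l) the two halves of the
commutator agree, whence the factor 2. -/
theorem generator_eq_trace (M : MajoranaSystem n ℋ) (h : Matrix (Fin (2 * n)) (Fin (2 * n)) ℂ)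
    {k l : Fin (2 * n)} (hkl : k ≠ l) :
    2 ^ n * generator h k l = 2 * opTrace ℋ (M.quadratic h * (M.γ l * M.γ k)) := by
  have h1 := congrArg (fun X => opTrace ℋ (X * M.γ k)) (M.quadratic_commutator h l)
  simp only [Finset.sum_mul, smul_mul_assoc, map_sum, map_smul, M.opTrace_γ_mul, smul_eq_mul,
    mul_ite, mul_zero, Finset.sum_ite_eq', Finset.mem_univ, if_true, sub_mul, map_sub] at h1
  rw [mul_comm, ← h1, mul_assoc (M.γ l), opTrace_comm ℋ (M.γ l), mul_assoc, mul_assoc,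
    M.anticomm_of_ne hkl, mul_neg, map_neg]
  ring

/-- A unitary that commutes with all Majorana operators but the `j`-th, with which it
anticommutes. -/
theorem exists_flip (M : MajoranaSystem n ℋ) (j : Fin (2 * n)) :
    ∃ U V : ℋ →L[ℂ] ℋ, U * V = 1 ∧ V * U = 1 ∧ U * M.γ j = -(M.γ j * U) ∧
      ∀ k, k ≠ j → U * M.γ k = M.γ k * U := by
  -- The product of all Majorana operators except the j-th. Moving γ_j past it crosses 2n − 1
  -- factors, moving another γ_k past it crosses 2n − 2. The signs are computed by inserting the
  -- full product of 2n factors −1, which equals 1.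
  let α : Fin (2 * n) → Fin 2 := fun i => if i = j then 0 else 1
  have hsign : ∀ k, conjSign k α = if k = j then -1 else 1 := by
    intro k
    have hone : ∀ a : Fin (2 * n), ∏ i, (if i = a then (-1 : ℂ) else 1) = -1 := by simp
    have hall : ∏ _i : Fin (2 * n), (-1 : ℂ) = 1 := by simp [pow_mul]
    split_ifs with hk
    · rw [← hone k, conjSign, ← one_mul (∏ i, _), ← hall, ← Finset.prod_mul_distrib]
      refine Finset.prod_congr rfl fun i _ => ?_
      by_cases hij : i = j <;> simp_all [α]
    · have h1 : (1 : ℂ) = (∏ _i : Fin (2 * n), (-1 : ℂ)) * (∏ i, (if i = k then (-1 : ℂ) else 1)) *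
          ∏ i, (if i = j then (-1 : ℂ) else 1) := by
        rw [hone, hone, hall]; norm_num
      rw [h1, conjSign, ← Finset.prod_mul_distrib, ← Finset.prod_mul_distrib]
      refine Finset.prod_congr rfl fun i _ => ?_
      by_cases hij : i = j
      · subst hij
        simp [α, Ne.symm hk]
      · by_cases hik : i = k <;> simp [α, hij, hik, hk]
  refine ⟨M.monomial α, star (M.monomial α), (M.monomial_unitary α).2,
    (M.monomial_unitary α).1, ?_, fun k hk => ?_⟩
  · have h := M.monomial_conj j α
    rw [hsign, if_pos rfl, neg_one_smul] at h
    have h2 := congrArg (M.γ j * ·) h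
    simpa [← mul_assoc, M.γ_sq] using h2
  · have h := M.monomial_conj k α
    rw [hsign, if_neg hk, one_smul] at h
    have h2 := congrArg (M.γ k * ·) h
    simpa [← mul_assoc, M.γ_sq] using h2

theorem opTrace_eq_zero_of_flip {X U V : ℋ →L[ℂ] ℋ} (hUV : U * V = 1) (hVU : V * U = 1) (hX : U * X = -(X * U)) :
    opTrace ℋ X = 0 := by
  have h1 : opTrace ℋ X = -opTrace ℋ X := by
    calc opTrace ℋ X = opTrace ℋ (V * (U * X)) := by rw [← mul_assoc, hVU, one_mul]
      _ = -opTrace ℋ (V * (X * U)) := by rw [hX, mul_neg, map_neg]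
      _ = -opTrace ℋ X := by
        rw [opTrace_comm, mul_assoc, hUV, mul_one]
  exact self_eq_neg.mp h1

/-- The flip of mode l fixes W, which is generated by other modes, and fixes γ_k, but negates γ_l.
The traced operator is therefore conjugate to its own negative. -/
theorem opTrace_supported_eq_zero (M : MajoranaSystem n ℋ) {S : Set (Fin n)} {W : ℋ →L[ℂ] ℋ}
    (hW : M.IsSupportedOn S W) {k l : Fin (2 * n)} (hkl : k ≠ l)
    (hS : modeSite l ∉ S) : opTrace ℋ (W * (M.γ l * M.γ k)) = 0 := by
  obtain ⟨U, V, hUV, hVU, hj, hk⟩ := M.exists_flip l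
  refine opTrace_eq_zero_of_flip hUV hVU ?_
  have hUW : U * W = W * U := by
    have h1 : W ∈ Subalgebra.centralizer ℂ {U} := by
      refine Algebra.adjoin_le (S := Subalgebra.centralizer ℂ {U}) ?_ hW
      rintro _ ⟨i, hi, rfl⟩
      rw [SetLike.mem_coe, Subalgebra.mem_centralizer_iff]
      rintro _ rfl
      exact hk i fun h => hS (h ▸ hi)
    exact (Subalgebra.mem_centralizer_iff ℂ).mp h1 U rfl
  calc U * (W * (M.γ l * M.γ k)) = (U * W) * M.γ l * M.γ k := by noncomm_ring
    _ = W * (U * M.γ l) * M.γ k := by rw [hUW]; noncomm_ring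
    _ = -(W * M.γ l * (U * M.γ k)) := by rw [hj]; noncomm_ring
    _ = -(W * (M.γ l * M.γ k) * U) := by rw [hk k hkl]; noncomm_ring

/-- A local term contributes to T_{kl} only if its ball contains both sites, and then its trace is
at most 2^n in modulus because all factors are contractions. -/
theorem norm_generator_le (M : MajoranaSystem n ℋ) {D : ℕ} (site : Fin n ↪ (Fin D → ℤ)) {r : ℝ}
    (h : Matrix (Fin (2 * n)) (Fin (2 * n)) ℂ)
    (hloc : M.IsGeometricallyLocal site 1 r (M.quadratic h)) (k l : Fin (2 * n)) :
    ‖generator h k l‖ ≤ 2 * (Finset.univ.filter fun a =>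
      latticeDist (site a) (site (modeSite k)) ≤ r ∧
        latticeDist (site a) (site (modeSite l)) ≤ r).card := by
  classical
  by_cases hkl : k = l
  · subst hkl
    -- Antisymmetry makes the diagonal zero.
    simp [generator]
  obtain ⟨w, hw, hloc⟩ := hloc
  have h1 := M.generator_eq_trace h hkl
  have hterm : ∀ a, ‖opTrace ℋ (w a * (M.γ l * M.γ k))‖ ≤
      if latticeDist (site a) (site (modeSite k)) ≤ r ∧
        latticeDist (site a) (site (modeSite l)) ≤ r then 2 ^ n else 0 := by
    intro a
    split_ifs with ha
    · refine (M.norm_opTrace_le _).trans ?_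
      have h2 : ‖w a * (M.γ l * M.γ k)‖ ≤ 1 * (1 * 1) := by
        refine (norm_mul_le _ _).trans (mul_le_mul (hloc a).2 ?_ (norm_nonneg _) zero_le_one)
        exact (norm_mul_le _ _).trans
          (mul_le_mul (M.norm_γ_le l) (M.norm_γ_le k) (norm_nonneg _) zero_le_one)
      calc (2 : ℝ) ^ n * ‖w a * (M.γ l * M.γ k)‖ ≤ 2 ^ n * (1 * (1 * 1)) := by gcongr
        _ = 2 ^ n := by ring
    · rw [not_and_or] at ha
      rw [norm_le_zero_iff]
      rcases ha with ha | ha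
      · rw [M.anticomm_of_ne (Ne.symm hkl), mul_neg, map_neg,
          M.opTrace_supported_eq_zero (hloc a).1 (Ne.symm hkl) ha, neg_zero]
      · exact M.opTrace_supported_eq_zero (hloc a).1 hkl ha
  have h2 : ‖(2 : ℂ) ^ n * generator h k l‖ ≤ 2 * ∑ a, (if latticeDist (site a)
      (site (modeSite k)) ≤ r ∧ latticeDist (site a) (site (modeSite l)) ≤ r then 2 ^ n else 0) := by
    rw [h1, hw, Finset.sum_mul, map_sum, norm_mul, Complex.norm_two]
    gcongr
    exact norm_sum_le_of_le _ fun a _ => hterm a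
  rw [← Finset.sum_filter, Finset.sum_const, nsmul_eq_mul, norm_mul, norm_pow,
    Complex.norm_two] at h2
  have h3 : (0 : ℝ) < 2 ^ n := by positivity
  refine le_of_mul_le_mul_left ?_ h3
  linarith

end MajoranaSystem

/-- A bound on the weighted row sums of the generator. -/
def generatorBound (D : ℕ) (r : ℝ) : ℝ :=
  4 * Real.exp (2 * r) * ballCount D r * ballCount D r

theorem MajoranaSystem.sum_norm_generator_le (M : MajoranaSystem n ℋ) {D : ℕ}
    (site : Fin n ↪ (Fin D → ℤ)) {r : ℝ} (h : Matrix (Fin (2 * n)) (Fin (2 * n)) ℂ)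
    (hloc : M.IsGeometricallyLocal site 1 r (M.quadratic h)) (k : Fin (2 * n)) :
    ∑ l, ‖generator h k l‖ * Real.exp (latticeDist (site (modeSite k)) (site (modeSite l)))
      ≤ generatorBound D r := by
  classical
  let P : Fin n → Fin (2 * n) → Prop := fun a l => latticeDist (site a) (site (modeSite l)) ≤ r
  have h1 : ∀ l, ‖generator h k l‖ *
      Real.exp (latticeDist (site (modeSite k)) (site (modeSite l)))
      ≤ ∑ a ∈ Finset.univ.filter (P · k), if P a l then 2 * Real.exp (2 * r) else 0 := by
    intro l
    rw [← Finset.sum_filter, Finset.filter_filter, Finset.sum_const, nsmul_eq_mul]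
    have h2 := M.norm_generator_le site h hloc k l
    -- Either no ball contains both sites and the entry is zero, or a common centre forces their
    -- distance to be at most 2r, so that the weight is at most e^{2r}.
    rcases (Finset.univ.filter fun a => P a k ∧ P a l).eq_empty_or_nonempty with h0 | ⟨a, ha⟩
    · simp only [P] at h0
      rw [h0, Finset.card_empty, Nat.cast_zero, mul_zero] at h2
      rw [le_antisymm h2 (norm_nonneg _), zero_mul]
      positivity
    · rw [Finset.mem_filter] at ha
      have h4 : latticeDist (site (modeSite k)) (site (modeSite l)) ≤ 2 * r := by
        have h5 := latticeDist_triangle (site (modeSite k)) (site a) (site (modeSite l))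
        rw [latticeDist_comm _ (site a)] at h5
        have h6 := ha.2.1
        have h7 := ha.2.2
        simp only [P] at h6 h7
        linarith
      calc _ ≤ (2 * ((Finset.univ.filter fun a => P a k ∧ P a l).card : ℝ)) *
            Real.exp (2 * r) := by
            gcongr
        _ = _ := by ring
  refine (Finset.sum_le_sum fun l _ => h1 l).trans ?_
  rw [Finset.sum_comm]
  -- After the exchange of sums: at most `ballCount` centres see k, each ball holds at most 2 ·
  -- `ballCount` modes, and each pair costs 2e^{2r}. Their product is `generatorBound`.
  have h8 : ∀ a ∈ Finset.univ.filter (P · k),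
      (∑ l, if P a l then 2 * Real.exp (2 * r) else 0)
        ≤ 2 * ballCount D r * (2 * Real.exp (2 * r)) := by
    intro a _
    rw [← Finset.sum_filter, Finset.sum_const, nsmul_eq_mul]
    gcongr
    have h9 := (card_modes_le (Finset.univ.filter fun b =>
      latticeDist (site a) (site b) ≤ r)).trans (Nat.mul_le_mul_left 2 (card_ball_le site r a))
    simp only [Finset.mem_filter, Finset.mem_univ, true_and] at h9
    exact_mod_cast h9
  refine (Finset.sum_le_sum h8).trans ?_
  rw [Finset.sum_const, nsmul_eq_mul]
  have h10 : (Finset.univ.filter (P · k)).card ≤ ballCount D r := by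
    refine le_trans (Finset.card_le_card fun a ha => ?_) (card_ball_le site r (modeSite k))
    rw [Finset.mem_filter] at ha ⊢
    rw [latticeDist_comm]
    exact ha
  have h11 : ((Finset.univ.filter (P · k)).card : ℝ) ≤ ballCount D r := by exact_mod_cast h10
  rw [generatorBound]
  calc _ ≤ (ballCount D r : ℝ) * (2 * ballCount D r * (2 * Real.exp (2 * r))) := by gcongr
    _ = _ := by ring

/-! ### Weighted bounds for matrix exponentials -/

theorem norm_exp_le_exp_norm {A : Type*} [NormedRing A] [NormOneClass A] [NormedAlgebra ℂ A]
    [CompleteSpace A] (x : A) : ‖NormedSpace.exp x‖ ≤ Real.exp ‖x‖ := by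
  rw [NormedSpace.exp_eq_tsum ℂ, Real.exp_eq_exp_ℝ, NormedSpace.exp_eq_tsum ℝ]
  have hs := NormedSpace.norm_expSeries_summable' (𝕂 := ℂ) x
  refine (norm_tsum_le_tsum_norm hs).trans (hs.tsum_le_tsum (fun m => ?_) ?_)
  · rw [norm_smul, norm_inv, Complex.norm_natCast, smul_eq_mul]
    gcongr
    exact norm_pow_le x m
  · exact (NormedSpace.norm_expSeries_summable' (𝕂 := ℝ) ‖x‖).of_norm

section
attribute [local instance] Matrix.linftyOpNormedRing Matrix.linftyOpNormedAlgebra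
  Matrix.linfty_opNormOneClass

theorem linfty_norm_le {ι : Type*} [Fintype ι] [DecidableEq ι] [Nonempty ι] {A : Matrix ι ι ℂ}
    {c : ℝ} (h : ∀ i, ∑ j, ‖A i j‖ ≤ c) : ‖A‖ ≤ c := by
  have hc : 0 ≤ c := (Finset.sum_nonneg fun j _ => norm_nonneg _).trans (h (Classical.arbitrary ι))
  lift c to NNReal using hc
  rw [Matrix.linfty_opNorm_def, NNReal.coe_le_coe]
  refine Finset.sup_le fun i _ => ?_
  rw [← NNReal.coe_le_coe]
  push_cast
  exact h i

theorem sum_norm_le_linfty {ι : Type*} [Fintype ι] [DecidableEq ι] (A : Matrix ι ι ℂ) (i : ι) :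
    ∑ j, ‖A i j‖ ≤ ‖A‖ := by
  rw [Matrix.linfty_opNorm_def]
  have h := Finset.le_sup (f := fun i => ∑ j, ‖A i j‖₊) (Finset.mem_univ i)
  rw [← NNReal.coe_le_coe] at h
  push_cast at h
  exact h

/-- A Combes–Thomas type estimate: weighted row sums of `exp (z T)`. -/
theorem sum_norm_exp_le {ι : Type*} [Fintype ι] [DecidableEq ι] (d : ι → ι → ℝ)
    (hd : ∀ i, d i i = 0) (htri : ∀ i j k, d i k ≤ d i j + d j k) {T : Matrix ι ι ℂ} {c : ℝ}
    (hT : ∀ i, ∑ j, ‖T i j‖ * Real.exp (d i j) ≤ c) (z : ℂ) (k : ι) :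
    ∑ l, ‖(NormedSpace.exp (z • T)) k l‖ * Real.exp (d k l) ≤ Real.exp (‖z‖ * c) := by
  have : Nonempty ι := ⟨k⟩
  -- Weights measured from the fixed row k. Conjugation scales the (i, j) entry by e^{d(k,j) −
  -- d(k,i)} ≤ e^{d(i,j)}, so the maximal row sum of the conjugated T is still at most c.
  -- Conjugation commutes with exp, and since d(k,k) = 0, row k of the result is exactly the
  -- weighted row wanted.
  let V : Matrix ι ι ℂ := Matrix.diagonal fun i => (Real.exp (-d k i) : ℂ)
  let V' : Matrix ι ι ℂ := Matrix.diagonal fun i => (Real.exp (d k i) : ℂ)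
  have hVV' : V * V' = 1 := by
    rw [Matrix.diagonal_mul_diagonal, ← Matrix.diagonal_one]
    congr 1; funext i
    rw [← Complex.ofReal_mul, ← Real.exp_add]; simp
  have hV'V : V' * V = 1 := by
    rw [Matrix.diagonal_mul_diagonal, ← Matrix.diagonal_one]
    congr 1; funext i
    rw [← Complex.ofReal_mul, ← Real.exp_add]; simp
  have hn : ∀ (A : Matrix ι ι ℂ) i j, ‖(V * A * V') i j‖
      = ‖A i j‖ * Real.exp (d k j - d k i) := by
    intro A i j
    rw [Matrix.mul_diagonal, Matrix.diagonal_mul, norm_mul, norm_mul, Complex.norm_real,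
      Complex.norm_real, Real.norm_eq_abs, Real.norm_eq_abs, abs_of_pos (Real.exp_pos _),
      abs_of_pos (Real.exp_pos _), sub_eq_neg_add, Real.exp_add]
    ring
  have h1 : ‖V * T * V'‖ ≤ c := by
    refine linfty_norm_le fun i => le_trans (Finset.sum_le_sum fun j _ => ?_) (hT i)
    rw [hn]
    gcongr
    linarith [htri k i j]
  have h2 := sum_norm_le_linfty (V * NormedSpace.exp (z • T) * V') k
  simp only [hn, hd, sub_zero] at h2
  refine h2.trans ?_
  have h3 : NormedSpace.exp (V * (z • T) * V') = V * NormedSpace.exp (z • T) * V' :=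
    Matrix.exp_units_conj ⟨V, V', hVV', hV'V⟩ (z • T)
  rw [← h3]
  refine (norm_exp_le_exp_norm _).trans (Real.exp_le_exp.mpr ?_)
  rw [mul_smul_comm, smul_mul_assoc, norm_smul]
  gcongr

theorem hasDerivAt_exp_entry {ι : Type*} [Fintype ι] [DecidableEq ι] (T : Matrix ι ι ℂ) (z : ℂ)
    (k l : ι) : HasDerivAt (fun z : ℂ => (NormedSpace.exp (z • T)) k l)
      ((T * NormedSpace.exp (z • T)) k l) z := by
  have h := hasDerivAt_exp_smul_const' T z
  exact (LinearMap.toContinuousLinearMap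
    (Matrix.entryLinearMap ℂ ℂ k l)).hasFDerivAt.comp_hasDerivAt z h

theorem exp_add_smul {ι : Type*} [Fintype ι] [DecidableEq ι] (T : Matrix ι ι ℂ) (z w : ℂ) :
    NormedSpace.exp ((z + w) • T) = NormedSpace.exp (z • T) * NormedSpace.exp (w • T) := by
  rw [add_smul]
  exact Matrix.exp_add_of_commute _ _ (((Commute.refl T).smul_left z).smul_right w)

end

theorem continuous_exp_entry {ι : Type*} [Fintype ι] [DecidableEq ι] (T : Matrix ι ι ℂ)
    (k l : ι) : Continuous fun z : ℂ => (NormedSpace.exp (z • T)) k l :=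
  continuous_iff_continuousAt.mpr fun z => (hasDerivAt_exp_entry T z k l).continuousAt

/-! ### Free evolution of the Majorana operators -/

theorem exp_add_smul_op {A : Type*} [NormedRing A] [NormedAlgebra ℂ A] [CompleteSpace A] (x : A)
    (z w : ℂ) :
    NormedSpace.exp ((z + w) • x) = NormedSpace.exp (z • x) * NormedSpace.exp (w • x) := by
  let _ : NormedAlgebra ℚ A := NormedAlgebra.restrictScalars ℚ ℂ A
  rw [add_smul]
  exact NormedSpace.exp_add_of_commute (((Commute.refl x).smul_left z).smul_right w)

theorem exp_neg_smul_mul {A : Type*} [NormedRing A] [NormedAlgebra ℂ A] [CompleteSpace A] (x : A)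
    (z : ℂ) : NormedSpace.exp (z • x) * NormedSpace.exp ((-z) • x) = 1 := by
  rw [← exp_add_smul_op, add_neg_cancel, zero_smul, NormedSpace.exp_zero]

namespace MajoranaSystem

/-- Both sides solve the linear equation G' = [H, G] with the same value at z = 0, by
`quadratic_commutator`. -/
theorem exp_conj_γ (M : MajoranaSystem n ℋ) (h : Matrix (Fin (2 * n)) (Fin (2 * n)) ℂ) (z : ℂ)
    (l : Fin (2 * n)) :
    NormedSpace.exp (z • M.quadratic h) * M.γ l * NormedSpace.exp ((-z) • M.quadratic h)
      = ∑ k, (NormedSpace.exp (z • generator h)) k l • M.γ k := by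
  set H := M.quadratic h with hH
  set T := generator h with hT
  let G : ℂ → (ℋ →L[ℂ] ℋ) := fun z => ∑ k, (NormedSpace.exp (z • T)) k l • M.γ k
  have hG : ∀ z, HasDerivAt G (H * G z - G z * H) z := by
    intro z
    have h1 : HasDerivAt G (∑ k, (T * NormedSpace.exp (z • T)) k l • M.γ k) z :=
      HasDerivAt.fun_sum fun k _ => (hasDerivAt_exp_entry T z k l).smul_const (M.γ k)
    convert h1 using 1
    simp only [G, Finset.mul_sum, Finset.sum_mul, ← Finset.sum_sub_distrib, mul_smul_comm,
      smul_mul_assoc, ← smul_sub]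
    simp only [hH, M.quadratic_commutator, ← hT, Matrix.mul_apply, Finset.sum_smul,
      Finset.smul_sum, smul_smul]
    rw [Finset.sum_comm]
    simp only [mul_comm]
  -- Undoing the evolution turns uniqueness for the differential equation into constancy of F.
  let F : ℂ → (ℋ →L[ℂ] ℋ) := fun z =>
    NormedSpace.exp ((-z) • H) * G z * NormedSpace.exp (z • H)
  have hF : ∀ z, HasDerivAt F 0 z := by
    intro z
    have h1 : HasDerivAt (fun u : ℂ => NormedSpace.exp ((-u) • H))
        (-(NormedSpace.exp ((-z) • H) * H)) z := by
      have h2 := (hasDerivAt_exp_smul_const H (-z)).scomp z (hasDerivAt_neg z)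
      simpa [Function.comp_def] using h2
    refine ((h1.mul (hG z)).mul (hasDerivAt_exp_smul_const' H z)).congr_deriv ?_
    simp only [Pi.mul_apply]
    noncomm_ring
  have hconst : F z = F 0 :=
    is_const_of_deriv_eq_zero (fun z => (hF z).differentiableAt) (fun z => (hF z).deriv) z 0
  have hF0 : F 0 = M.γ l := by
    simp [F, G, NormedSpace.exp_zero, Matrix.one_apply]
  rw [hF0] at hconst
  have e1 := exp_neg_smul_mul H z
  rw [← hconst]
  calc NormedSpace.exp (z • H) * (NormedSpace.exp ((-z) • H) * G z * NormedSpace.exp (z • H)) *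
        NormedSpace.exp ((-z) • H)
      = (NormedSpace.exp (z • H) * NormedSpace.exp ((-z) • H)) * G z *
        (NormedSpace.exp (z • H) * NormedSpace.exp ((-z) • H)) := by noncomm_ring
    _ = G z := by rw [e1, one_mul, mul_one]

theorem gammaFree_eq (M : MajoranaSystem n ℋ) (h : Matrix (Fin (2 * n)) (Fin (2 * n)) ℂ)
    (l : Fin (2 * n)) (t : ℝ) :
    M.gammaFree (M.quadratic h) l t
      = ∑ k, (NormedSpace.exp ((Complex.I * t) • generator h)) k l • M.γ k :=
  M.exp_conj_γ h _ l

/-- By the group law, the outer conjugation only shifts the time of the free evolution. With z =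
−β/4 this is the similarity transformation in the jump operators. -/
theorem exp_conj_gammaFree (M : MajoranaSystem n ℋ) (h : Matrix (Fin (2 * n)) (Fin (2 * n)) ℂ)
    (z : ℂ) (l : Fin (2 * n)) (t : ℝ) :
    NormedSpace.exp (z • M.quadratic h) * M.gammaFree (M.quadratic h) l t *
        NormedSpace.exp ((-z) • M.quadratic h)
      = ∑ k, (NormedSpace.exp ((z + Complex.I * t) • generator h)) k l • M.γ k := by
  rw [← M.exp_conj_γ, exp_add_smul_op, neg_add, add_comm (-z), exp_add_smul_op, gammaFree]
  noncomm_ring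

theorem continuous_gammaFree (M : MajoranaSystem n ℋ)
    (h : Matrix (Fin (2 * n)) (Fin (2 * n)) ℂ) (l : Fin (2 * n)) :
    Continuous (M.gammaFree (M.quadratic h) l) := by
  have h1 : M.gammaFree (M.quadratic h) l = fun t : ℝ =>
      ∑ k, (NormedSpace.exp ((Complex.I * t) • generator h)) k l • M.γ k :=
    funext (M.gammaFree_eq h l)
  rw [h1]
  refine continuous_finsetSum _ fun k _ => ?_
  exact ((continuous_exp_entry (generator h) k l).comp
    (continuous_const.mul Complex.continuous_ofReal)).smul continuous_const

theorem norm_exp_I_smul_le (M : MajoranaSystem n ℋ) {H : ℋ →L[ℂ] ℋ} (hH : IsSelfAdjoint H)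
    (t : ℝ) : ‖NormedSpace.exp ((Complex.I * t) • H)‖ ≤ 1 := by
  have := M.nontrivial_space
  have h1 : IsSelfAdjoint (t • H) := (IsSelfAdjoint.all t).smul hH
  have h2 := CStarRing.norm_coe_unitary (selfAdjoint.expUnitary ⟨t • H, h1⟩)
  rw [selfAdjoint.expUnitary_coe] at h2
  rw [mul_smul]
  exact h2.le

/-- Real-time evolution is unitary. This serves the integrability of the operator-valued integrands;
the decay comes from the matrix estimates instead. -/
theorem norm_gammaFree_le (M : MajoranaSystem n ℋ) {H : ℋ →L[ℂ] ℋ} (hH : IsSelfAdjoint H)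
    (l : Fin (2 * n)) (t : ℝ) : ‖M.gammaFree H l t‖ ≤ 1 := by
  have h1 := M.norm_exp_I_smul_le hH t
  have h2 := M.norm_exp_I_smul_le hH (-t)
  rw [Complex.ofReal_neg, mul_neg] at h2
  refine (norm_mul_le _ _).trans (mul_le_one₀ ?_ (norm_nonneg _) h2)
  exact (norm_mul_le _ _).trans (mul_le_one₀ h1 (norm_nonneg _) (M.norm_γ_le l))

end MajoranaSystem

/-! ### The filter functions -/

theorem continuous_filterF (β : ℝ) : Continuous (filterF β) := by
  unfold filterF
  fun_prop

theorem filterF_nonneg (β t : ℝ) : 0 ≤ filterF β t := by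
  unfold filterF
  positivity

theorem integrable_filterF_mul_exp {β : ℝ} (hβ : 0 < β) (c : ℝ) :
    Integrable fun t => filterF β t * Real.exp ((β / 4 + |t|) * c) := by
  have h1 : Integrable fun t : ℝ => (1 / √(β * √(Real.pi / 2)) *
      Real.exp (β / 4 * c + c ^ 2 * β ^ 2 / 2)) * Real.exp (-(1 / (2 * β ^ 2)) * t ^ 2) :=
    (integrable_exp_neg_mul_sq (by positivity)).const_mul _
  refine h1.mono' ?_ (Filter.Eventually.of_forall fun t => ?_)
  · exact ((continuous_filterF β).mul (by fun_prop)).aestronglyMeasurable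
  · rw [Real.norm_of_nonneg (mul_nonneg (filterF_nonneg β t) (Real.exp_pos _).le), filterF,
      mul_assoc, mul_assoc, ← Real.exp_add, ← Real.exp_add]
    refine mul_le_mul_of_nonneg_left (Real.exp_le_exp.mpr ?_) (by positivity)
    -- Completing the square gives |t|c ≤ t²/(2β²) + c²β²/2: half of the Gaussian exponent absorbs
    -- the exponential growth.
    have h2 : 0 ≤ (|t| / β - c * β) ^ 2 := sq_nonneg _
    have h3 : (|t| / β - c * β) ^ 2 = t ^ 2 / β ^ 2 - 2 * (|t| * c) + c ^ 2 * β ^ 2 := by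
      rw [← sq_abs t]
      field_simp
      ring
    have h4 : -(1 / (2 * β ^ 2)) * t ^ 2 = -(t ^ 2 / β ^ 2) / 2 := by
      field_simp
    rw [h4, neg_div]
    linarith

theorem continuous_etaW (β : ℝ) : Continuous (etaW β) := by
  unfold etaW
  fun_prop

theorem integrable_etaW {β : ℝ} (hβ : 0 < β) : Integrable (etaW β) := by
  have h1 : Integrable fun x : ℝ => Real.exp (-(1 / 2) * x ^ 2) :=
    integrable_exp_neg_mul_sq (by norm_num)
  have h2 := (h1.comp_add_right 1).comp_mul_left' hβ.ne'
  convert h2 using 2 with x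
  rw [etaW]
  congr 1
  ring

theorem integrable_b₂ : Integrable b₂ := by
  have h := (integrable_cexp_quadratic' (b := -4) (by norm_num) (-2 * Complex.I) 0).const_mul
    (1 / (2 * (Real.pi ^ (3 / 2 : ℝ) : ℝ)) : ℂ)
  refine h.congr (Filter.Eventually.of_forall fun t => ?_)
  simp only [b₂]
  congr 2
  ring

theorem integrable_inv_cosh : Integrable fun s : ℝ => 1 / Real.cosh (2 * Real.pi * s) := by
  have h1 : Integrable fun s : ℝ => 2 * (1 + s ^ 2)⁻¹ := integrable_inv_one_add_sq.const_mul 2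
  have hcont : Continuous fun s : ℝ => 1 / Real.cosh (2 * Real.pi * s) :=
    continuous_const.div (Real.continuous_cosh.comp (by fun_prop)) fun s => (Real.cosh_pos _).ne'
  refine h1.mono' hcont.aestronglyMeasurable (Filter.Eventually.of_forall fun s => ?_)
  rw [Real.norm_of_nonneg (by positivity), ← div_eq_mul_inv,
    div_le_div_iff₀ (Real.cosh_pos _) (by positivity)]
  -- With x = 2πs, cosh x ≥ e^{|x|}/2, and the quadratic lower bound on e^{|x|} together with x² ≥
  -- 4s² gives the comparison with 2/(1 + s²).
  have h2 := Real.quadratic_le_exp_of_nonneg (abs_nonneg (2 * Real.pi * s))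
  have h3 : (2 * s) ^ 2 ≤ |2 * Real.pi * s| ^ 2 := by
    rw [sq_abs, mul_right_comm, mul_pow (2 * s)]
    exact le_mul_of_one_le_right (sq_nonneg _)
      (one_le_pow₀ (by linarith [Real.pi_gt_three]))
  rw [← Real.cosh_abs, Real.cosh_eq]
  have h4 := Real.exp_pos (-|2 * Real.pi * s|)
  have h5 := abs_nonneg (2 * Real.pi * s)
  linarith [sq_nonneg s]

theorem integrable_sin_gaussian :
    Integrable fun t : ℝ => Real.sin (-t) * Real.exp (-2 * t ^ 2) := by
  refine (integrable_exp_neg_mul_sq (b := 2) two_pos).mono'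
    (by fun_prop) (Filter.Eventually.of_forall fun t => ?_)
  rw [norm_mul, Real.norm_of_nonneg (Real.exp_pos _).le]
  exact mul_le_of_le_one_left (Real.exp_pos _).le (Real.abs_sin_le_one _)

theorem integrable_b₁ : Integrable b₁ :=
  (integrable_inv_cosh.integrable_convolution (ContinuousLinearMap.mul ℝ ℝ)
    integrable_sin_gaussian).const_mul _

/-- The convolution of an even kernel with an odd function is odd; substitute s ↦ −s. -/
theorem b₁_neg (t : ℝ) : b₁ (-t) = -b₁ t := by
  rw [b₁, b₁, ← mul_neg, ← integral_neg]
  congr 1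
  rw [← integral_neg_eq_self]
  refine integral_congr_ae (Filter.Eventually.of_forall fun s => ?_)
  have h1 : -t - -s = -(t - s) := by ring
  simp only [h1, mul_neg, Real.cosh_neg, neg_neg, Real.sin_neg, neg_sq]
  ring

theorem integral_b₁ : ∫ t, b₁ t = 0 := by
  have h := integral_neg_eq_self b₁ volume
  simp only [b₁_neg, integral_neg] at h
  exact neg_eq_self.mp h

namespace MajoranaSystem

/-! ### The coherent terms cancel -/

/-- Antisymmetry of T gives exp(itT)ᵀ = exp(−itT), so summing over j composes the two evolutions
into one that depends on the time difference only. -/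
theorem sum_gammaFree_mul (M : MajoranaSystem n ℋ) (h : Matrix (Fin (2 * n)) (Fin (2 * n)) ℂ)
    (s t : ℝ) :
    ∑ j, M.gammaFree (M.quadratic h) j s * M.gammaFree (M.quadratic h) j t =
      ∑ k, ∑ l, (NormedSpace.exp ((Complex.I * (s - t : ℝ)) • generator h)) k l •
        (M.γ k * M.γ l) := by
  have h1 : (Complex.I * (s - t : ℝ)) • generator h
      = (Complex.I * s + -(Complex.I * t)) • generator h := by
    congr 1; push_cast; ring
  have h2 : NormedSpace.exp ((-(Complex.I * t)) • generator h)
      = (NormedSpace.exp ((Complex.I * t) • generator h)).transpose := by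
    rw [← Matrix.exp_transpose, Matrix.transpose_smul, generator_transpose, smul_neg, neg_smul]
  simp only [gammaFree_eq, h1, exp_add_smul, h2, Matrix.mul_apply, Matrix.transpose_apply,
    Finset.sum_mul, Finset.mul_sum, smul_mul_smul_comm, Finset.sum_smul]
  conv_rhs => rw [Finset.sum_comm]
  rw [Finset.sum_comm]
  refine Finset.sum_congr rfl fun l _ => ?_
  rw [Finset.sum_comm]

/-- The inner integral in the coherent term. -/
def coherentInner (M : MajoranaSystem n ℋ) (β : ℝ) (H₀ : ℋ →L[ℂ] ℋ) (j : Fin (2 * n)) (t : ℝ) :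
    ℋ →L[ℂ] ℋ :=
  ∫ t' : ℝ, b₂ t' • (M.gammaFree H₀ j (β * (t' - t)) * M.gammaFree H₀ j (-β * (t + t')))

theorem norm_coherent_integrand_le (M : MajoranaSystem n ℋ) {H₀ : ℋ →L[ℂ] ℋ}
    (hH : IsSelfAdjoint H₀) (j : Fin (2 * n)) (s t : ℝ) (c : ℂ) :
    ‖c • (M.gammaFree H₀ j s * M.gammaFree H₀ j t)‖ ≤ ‖c‖ := by
  rw [norm_smul]
  refine mul_le_of_le_one_right (norm_nonneg _) ((norm_mul_le _ _).trans ?_)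
  exact mul_le_one₀ (M.norm_gammaFree_le hH j s) (norm_nonneg _) (M.norm_gammaFree_le hH j t)

theorem continuous_b₂ : Continuous b₂ := by
  unfold b₂
  fun_prop

theorem integrable_coherent_integrand (M : MajoranaSystem n ℋ) (β : ℝ)
    (h : Matrix (Fin (2 * n)) (Fin (2 * n)) ℂ) (hH : IsSelfAdjoint (M.quadratic h))
    (j : Fin (2 * n)) (t : ℝ) :
    Integrable fun t' : ℝ => b₂ t' • (M.gammaFree (M.quadratic h) j (β * (t' - t)) *
      M.gammaFree (M.quadratic h) j (-β * (t + t'))) := by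
  refine integrable_b₂.norm.mono' ?_ (Filter.Eventually.of_forall fun t' =>
    M.norm_coherent_integrand_le hH j _ _ _)
  have hc := M.continuous_gammaFree h j
  exact (continuous_b₂.smul ((hc.comp (by fun_prop)).mul
    (hc.comp (by fun_prop)))).aestronglyMeasurable

theorem continuous_coherentInner (M : MajoranaSystem n ℋ) (β : ℝ)
    (h : Matrix (Fin (2 * n)) (Fin (2 * n)) ℂ) (hH : IsSelfAdjoint (M.quadratic h))
    (j : Fin (2 * n)) : Continuous (M.coherentInner β (M.quadratic h) j) := by
  have hc := M.continuous_gammaFree h j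
  refine continuous_of_dominated (bound := fun t' => ‖b₂ t'‖)
    (fun t => (M.integrable_coherent_integrand β h hH j t).aestronglyMeasurable)
    (fun t => Filter.Eventually.of_forall fun t' => M.norm_coherent_integrand_le hH j _ _ _)
    integrable_b₂.norm (Filter.Eventually.of_forall fun t' => ?_)
  have h1 : Continuous fun t => M.gammaFree (M.quadratic h) j (β * (t' - t)) :=
    hc.comp (by fun_prop)
  have h2 : Continuous fun t => M.gammaFree (M.quadratic h) j (-β * (t + t')) :=
    hc.comp (by fun_prop)
  exact (h1.mul h2).const_smul (b₂ t')

theorem integrable_b₁_smul_coherentInner (M : MajoranaSystem n ℋ) (β : ℝ)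
    (h : Matrix (Fin (2 * n)) (Fin (2 * n)) ℂ) (hH : IsSelfAdjoint (M.quadratic h))
    (j : Fin (2 * n)) :
    Integrable fun t => (b₁ t : ℂ) • M.coherentInner β (M.quadratic h) j t := by
  have h1 : Integrable fun t => (b₁ t : ℂ) := integrable_b₁.ofReal
  refine (h1.norm.mul_const (∫ t', ‖b₂ t'‖)).mono'
    (h1.aestronglyMeasurable.smul
      (M.continuous_coherentInner β h hH j).aestronglyMeasurable)
    (Filter.Eventually.of_forall fun t => ?_)
  rw [norm_smul]
  gcongr
  exact norm_integral_le_of_norm_le integrable_b₂.norm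
    (Filter.Eventually.of_forall fun t' => M.norm_coherent_integrand_le hH j _ _ _)

/-- Once summed over j, the inner integral no longer depends on t, so the outer integral is a
multiple of ∫ b₁ = 0. The individual terms are not claimed to vanish. -/
theorem sum_coherentFree (M : MajoranaSystem n ℋ) (β : ℝ)
    (h : Matrix (Fin (2 * n)) (Fin (2 * n)) ℂ) (hH : IsSelfAdjoint (M.quadratic h)) :
    ∑ j, M.coherentFree β (M.quadratic h) j = 0 := by
  have h1 : ∀ t : ℝ, ∑ j, M.coherentInner β (M.quadratic h) j t = ∫ t' : ℝ, b₂ t' •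
      ∑ k, ∑ l, (NormedSpace.exp ((Complex.I * (2 * β * t' : ℝ)) • generator h)) k l •
        (M.γ k * M.γ l) := by
    intro t
    simp only [coherentInner]
    rw [← integral_finsetSum _ fun j _ => M.integrable_coherent_integrand β h hH j t]
    refine integral_congr_ae (Filter.Eventually.of_forall fun t' => ?_)
    simp only [← Finset.smul_sum, M.sum_gammaFree_mul h]
    -- The outer time cancels in the difference of the two arguments.
    have h2 : β * (t' - t) - -β * (t + t') = 2 * β * t' := by ring
    rw [h2]
  have h3 : ∑ j, ∫ t : ℝ, (b₁ t : ℂ) • M.coherentInner β (M.quadratic h) j t = 0 := by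
    rw [← integral_finsetSum _ fun j _ => M.integrable_b₁_smul_coherentInner β h hH j]
    simp only [← Finset.smul_sum, h1]
    rw [integral_smul_const, integral_complex_ofReal, integral_b₁, Complex.ofReal_zero, zero_smul]
  calc ∑ j, M.coherentFree β (M.quadratic h) j
      = NormedSpace.exp ((-(β / 4 : ℝ) : ℂ) • M.quadratic h) *
        (∑ j, ∫ t : ℝ, (b₁ t : ℂ) • M.coherentInner β (M.quadratic h) j t) *
        NormedSpace.exp (((β / 4 : ℝ) : ℂ) • M.quadratic h) := by
        rw [Finset.mul_sum, Finset.sum_mul]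
        rfl
    _ = 0 := by rw [h3, mul_zero, zero_mul]

theorem parentCoherentFree_eq_zero (M : MajoranaSystem n ℋ) (β : ℝ)
    (h : Matrix (Fin (2 * n)) (Fin (2 * n)) ℂ) (hH : IsSelfAdjoint (M.quadratic h)) :
    M.parentCoherentFree β (M.quadratic h) = 0 := by
  have h1 : Complex.I • ∑ j, (superL (M.coherentFree β (M.quadratic h) j)
      - superR (star (M.coherentFree β (M.quadratic h) j))) = 0 := by
    ext1 X
    simp only [smul_apply, sum_apply, sub_apply, superL_apply, superR_apply,
      Finset.sum_sub_distrib, ← Finset.sum_mul, ← Finset.mul_sum, ← star_sum,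
      M.sum_coherentFree β h hH]
    simp
  rw [parentCoherentFree, h1, map_zero]

end MajoranaSystem

/-! ### Coefficients of the jump operators -/

section coefficients

variable {ι : Type*} [Fintype ι] [DecidableEq ι]

/-- The coefficients of the transformed jump operators: the Gaussian-filtered Fourier transform of
`exp ((-β/4 + i t) T)`. -/
def jumpCoeff (β : ℝ) (T : Matrix ι ι ℂ) (ω : ℝ) : Matrix ι ι ℂ := fun k j =>
  (1 / (√(2 * Real.pi) : ℝ) : ℂ) * ∫ t : ℝ, (filterF β t * Complex.exp (-(Complex.I * ω * t))) *
    (NormedSpace.exp (((-(β / 4 : ℝ) : ℂ) + Complex.I * t) • T)) k j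

/-- The bound on the weighted row sums of `jumpCoeff`. -/
def jumpBound (β c : ℝ) : ℝ :=
  1 / √(2 * Real.pi) * ∫ t, filterF β t * Real.exp ((β / 4 + |t|) * c)

theorem norm_fourier_phase (ω t : ℝ) : ‖Complex.exp (-(Complex.I * ω * t))‖ = 1 := by
  have h : -(Complex.I * ω * t) = ((-(ω * t) : ℝ) : ℂ) * Complex.I := by push_cast; ring
  rw [h, Complex.norm_exp_ofReal_mul_I]

theorem norm_filter_phase (β ω t : ℝ) :
    ‖(filterF β t * Complex.exp (-(Complex.I * ω * t)) : ℂ)‖ = filterF β t := by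
  rw [norm_mul, norm_fourier_phase, mul_one, Complex.norm_real,
    Real.norm_of_nonneg (filterF_nonneg β t)]

theorem continuous_filter_phase (β ω : ℝ) :
    Continuous fun t : ℝ => (filterF β t * Complex.exp (-(Complex.I * ω * t)) : ℂ) :=
  (Complex.continuous_ofReal.comp (continuous_filterF β)).mul (by fun_prop)

/-- Weighted row sums of `exp (z T)` grow at most like `exp (‖z‖ c)`. -/
def HasExpRowBound (d : ι → ι → ℝ) (c : ℝ) (T : Matrix ι ι ℂ) : Prop :=
  ∀ (z : ℂ) (k : ι),
    ∑ l, ‖(NormedSpace.exp (z • T)) k l‖ * Real.exp (d k l) ≤ Real.exp (‖z‖ * c)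

variable {d : ι → ι → ℝ} {c β : ℝ} {T : Matrix ι ι ℂ}

theorem le_of_weighted_sum_le (hd : ∀ i j, 0 ≤ d i j) {A : Matrix ι ι ℂ} {B : ℝ} {k : ι}
    (h : ∑ l, ‖A k l‖ * Real.exp (d k l) ≤ B) (l : ι) : ‖A k l‖ ≤ B := by
  refine le_trans ?_ ((Finset.single_le_sum (f := fun l => ‖A k l‖ * Real.exp (d k l))
    (fun l _ => by positivity) (Finset.mem_univ l)).trans h)
  exact le_mul_of_one_le_right (norm_nonneg _) (Real.one_le_exp (hd k l))

theorem norm_jump_exponent_le (hβ : 0 < β) (t : ℝ) :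
    ‖(-(β / 4 : ℝ) : ℂ) + Complex.I * t‖ ≤ β / 4 + |t| := by
  refine (norm_add_le _ _).trans_eq ?_
  rw [norm_neg, Complex.norm_real, norm_mul, Complex.norm_I, one_mul, Complex.norm_real,
    Real.norm_of_nonneg (by positivity), Real.norm_eq_abs]

theorem HasExpRowBound.sum_le (hT : HasExpRowBound d c T) (hβ : 0 < β) (hc : 0 ≤ c) (t : ℝ)
    (k : ι) :
    ∑ l, ‖(NormedSpace.exp (((-(β / 4 : ℝ) : ℂ) + Complex.I * t) • T)) k l‖ * Real.exp (d k l)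
      ≤ Real.exp ((β / 4 + |t|) * c) := by
  refine (hT _ k).trans (Real.exp_le_exp.mpr ?_)
  gcongr
  exact norm_jump_exponent_le hβ t

theorem HasExpRowBound.norm_jump_integrand_le (hT : HasExpRowBound d c T) (hβ : 0 < β)
    (hc : 0 ≤ c) (hd : ∀ i j, 0 ≤ d i j) (ω t : ℝ) (k j : ι) :
    ‖(filterF β t * Complex.exp (-(Complex.I * ω * t))) *
      (NormedSpace.exp (((-(β / 4 : ℝ) : ℂ) + Complex.I * t) • T)) k j‖
      ≤ filterF β t * Real.exp ((β / 4 + |t|) * c) := by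
  rw [norm_mul, norm_filter_phase]
  exact mul_le_mul_of_nonneg_left (le_of_weighted_sum_le hd (hT.sum_le hβ hc t k) j)
    (filterF_nonneg β t)

theorem continuous_jump_integrand (ω : ℝ) (k j : ι) :
    Continuous fun t : ℝ => (filterF β t * Complex.exp (-(Complex.I * ω * t))) *
      (NormedSpace.exp (((-(β / 4 : ℝ) : ℂ) + Complex.I * t) • T)) k j :=
  (continuous_filter_phase β ω).mul ((continuous_exp_entry T k j).comp
    (continuous_const.add (continuous_const.mul Complex.continuous_ofReal)))

theorem HasExpRowBound.integrable_jump (hT : HasExpRowBound d c T) (hβ : 0 < β)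
    (hc : 0 ≤ c) (hd : ∀ i j, 0 ≤ d i j) (ω : ℝ) (k j : ι) :
    Integrable fun t : ℝ => (filterF β t * Complex.exp (-(Complex.I * ω * t))) *
      (NormedSpace.exp (((-(β / 4 : ℝ) : ℂ) + Complex.I * t) • T)) k j :=
  (integrable_filterF_mul_exp hβ c).mono' (continuous_jump_integrand ω k j).aestronglyMeasurable
    (Filter.Eventually.of_forall fun t => hT.norm_jump_integrand_le hβ hc hd ω t k j)

theorem HasExpRowBound.continuous_jumpCoeff (hT : HasExpRowBound d c T) (hβ : 0 < β)
    (hc : 0 ≤ c) (hd : ∀ i j, 0 ≤ d i j) (k j : ι) :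
    Continuous fun ω => jumpCoeff β T ω k j := by
  refine continuous_const.mul (continuous_of_dominated
    (fun ω => (continuous_jump_integrand ω k j).aestronglyMeasurable)
    (fun ω => Filter.Eventually.of_forall fun t => hT.norm_jump_integrand_le hβ hc hd ω t k j)
    (integrable_filterF_mul_exp hβ c) (Filter.Eventually.of_forall fun t => ?_))
  fun_prop

/-- The row sum is taken under the integral before estimating; bounding the entries one at a time
would cost a factor growing with the number of modes. -/
theorem HasExpRowBound.sum_norm_jumpCoeff_le (hT : HasExpRowBound d c T) (hβ : 0 < β)
    (hc : 0 ≤ c) (hd : ∀ i j, 0 ≤ d i j) (ω : ℝ) (k : ι) :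
    ∑ j, ‖jumpCoeff β T ω k j‖ * Real.exp (d k j) ≤ jumpBound β c := by
  have hint := fun j => ((hT.integrable_jump hβ hc hd ω k j).norm.mul_const (Real.exp (d k j)))
  have hpi : (0 : ℝ) ≤ 1 / √(2 * Real.pi) := by positivity
  have hnorm : ‖(1 / (√(2 * Real.pi) : ℝ) : ℂ)‖ = 1 / √(2 * Real.pi) := by
    rw [← Complex.ofReal_one, ← Complex.ofReal_div, Complex.norm_real, Real.norm_of_nonneg hpi]
  calc ∑ j, ‖jumpCoeff β T ω k j‖ * Real.exp (d k j)
      ≤ ∑ j, 1 / √(2 * Real.pi) * ∫ t : ℝ,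
          ‖(filterF β t * Complex.exp (-(Complex.I * ω * t))) *
            (NormedSpace.exp (((-(β / 4 : ℝ) : ℂ) + Complex.I * t) • T)) k j‖ *
              Real.exp (d k j) := by
        refine Finset.sum_le_sum fun j _ => ?_
        rw [jumpCoeff, norm_mul, hnorm, integral_mul_const, mul_assoc]
        gcongr
        exact norm_integral_le_integral_norm _
    _ = 1 / √(2 * Real.pi) * ∫ t : ℝ, ∑ j,
          ‖(filterF β t * Complex.exp (-(Complex.I * ω * t))) *
            (NormedSpace.exp (((-(β / 4 : ℝ) : ℂ) + Complex.I * t) • T)) k j‖ *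
              Real.exp (d k j) := by
        rw [integral_finsetSum _ fun j _ => hint j, Finset.mul_sum]
    _ ≤ jumpBound β c := by
        refine mul_le_mul_of_nonneg_left (integral_mono (integrable_finsetSum _ fun j _ => hint j)
          (integrable_filterF_mul_exp hβ c) fun t => ?_) hpi
        have h1 : ∀ j, ‖(filterF β t * Complex.exp (-(Complex.I * ω * t))) *
            (NormedSpace.exp (((-(β / 4 : ℝ) : ℂ) + Complex.I * t) • T)) k j‖ * Real.exp (d k j)
            = filterF β t * (‖(NormedSpace.exp (((-(β / 4 : ℝ) : ℂ) + Complex.I * t) • T)) k j‖ *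
              Real.exp (d k j)) := fun j => by
          rw [norm_mul, norm_filter_phase, mul_assoc]
        simp only [h1, ← Finset.mul_sum]
        exact mul_le_mul_of_nonneg_left (hT.sum_le hβ hc t k) (filterF_nonneg β t)

/-- A family of matrices, continuous in the frequency, with uniformly bounded weighted row sums. -/
structure IsBoundedFamily (d : ι → ι → ℝ) (B : ℝ) (u : ℝ → Matrix ι ι ℂ) : Prop where
  continuous : ∀ k j, Continuous fun ω => u ω k j
  sum_le : ∀ ω k, ∑ j, ‖u ω k j‖ * Real.exp (d k j) ≤ B

theorem IsBoundedFamily.neg {B : ℝ} {u : ℝ → Matrix ι ι ℂ} (hu : IsBoundedFamily d B u) :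
    IsBoundedFamily d B fun ω => u (-ω) :=
  ⟨fun k j => (hu.continuous k j).comp continuous_neg, fun ω => hu.sum_le (-ω)⟩

theorem IsBoundedFamily.conj {B : ℝ} {u : ℝ → Matrix ι ι ℂ} (hu : IsBoundedFamily d B u) :
    IsBoundedFamily d B fun ω k j => conj (u ω k j) :=
  ⟨fun k j => Complex.continuous_conj.comp (hu.continuous k j), fun ω k => by
    simpa only [RCLike.norm_conj] using hu.sum_le ω k⟩

theorem HasExpRowBound.isBoundedFamily (hT : HasExpRowBound d c T) (hβ : 0 < β)
    (hc : 0 ≤ c) (hd : ∀ i j, 0 ≤ d i j) : IsBoundedFamily d (jumpBound β c) (jumpCoeff β T) :=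
  ⟨hT.continuous_jumpCoeff hβ hc hd, hT.sum_norm_jumpCoeff_le hβ hc hd⟩

theorem IsBoundedFamily.norm_mul_le {B : ℝ} {u v : ℝ → Matrix ι ι ℂ}
    (hd : ∀ i j, 0 ≤ d i j) (hu : IsBoundedFamily d B u) (hv : IsBoundedFamily d B v) (ω : ℝ)
    (k l i j : ι) : ‖(etaW β ω : ℂ) * (u ω k i * v ω l j)‖ ≤ etaW β ω * (B * B) := by
  have h1 := le_of_weighted_sum_le hd (hu.sum_le ω k) i
  have h2 := le_of_weighted_sum_le hd (hv.sum_le ω l) j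
  have h3 : 0 ≤ etaW β ω := (Real.exp_pos _).le
  rw [norm_mul, norm_mul, Complex.norm_real, Real.norm_of_nonneg h3]
  exact mul_le_mul_of_nonneg_left (mul_le_mul h1 h2 (norm_nonneg _) ((norm_nonneg _).trans h1)) h3

theorem IsBoundedFamily.integrable_mul {B : ℝ} {u v : ℝ → Matrix ι ι ℂ} (hβ : 0 < β)
    (hd : ∀ i j, 0 ≤ d i j) (hu : IsBoundedFamily d B u) (hv : IsBoundedFamily d B v)
    (k l i j : ι) : Integrable fun ω => (etaW β ω : ℂ) * (u ω k i * v ω l j) := by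
  refine ((integrable_etaW hβ).mul_const (B * B)).mono' (Continuous.aestronglyMeasurable ?_)
    (Filter.Eventually.of_forall fun ω => hu.norm_mul_le hd hv ω k l i j)
  exact (Complex.continuous_ofReal.comp (continuous_etaW β)).mul
    ((hu.continuous k i).mul (hv.continuous l j))

/-- The matrix `∫ dω η(ω) u(ω) v(ω)ᵀ`. -/
def etaPairing (β : ℝ) (u v : ℝ → Matrix ι ι ℂ) : Matrix ι ι ℂ := fun k l =>
  ∑ j, ∫ ω, (etaW β ω : ℂ) * (u ω k j * v ω l j)

/-- Both rows are localized near the common label j, and e^{d(k,l)} ≤ e^{d(k,j)} e^{d(l,j)} splits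
the weight between them. One factor is bounded entrywise by B, and the row sum of the other gives
the second B. -/
theorem norm_etaPairing_le {B : ℝ} {u v : ℝ → Matrix ι ι ℂ} (hβ : 0 < β)
    (hd : ∀ i j, 0 ≤ d i j) (hsymm : ∀ i j, d i j = d j i)
    (htri : ∀ i j k, d i k ≤ d i j + d j k) (hu : IsBoundedFamily d B u)
    (hv : IsBoundedFamily d B v) (k l : ι) :
    ‖etaPairing β u v k l‖ ≤ (∫ ω, etaW β ω) * (B * B) * Real.exp (-d k l) := by
  rw [Real.exp_neg, ← div_eq_mul_inv, le_div_iff₀ (Real.exp_pos _), etaPairing,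
    ← integral_finsetSum _ fun j _ => hu.integrable_mul hβ hd hv k l j j]
  have hη : ∀ ω, 0 ≤ etaW β ω := fun ω => (Real.exp_pos _).le
  have h1 : ∀ ω, ‖∑ j, (etaW β ω : ℂ) * (u ω k j * v ω l j)‖
      ≤ etaW β ω * (B * B) * Real.exp (-d k l) := by
    intro ω
    rw [← Finset.mul_sum, norm_mul, Complex.norm_real, Real.norm_of_nonneg (hη ω), mul_assoc]
    refine mul_le_mul_of_nonneg_left ?_ (hη ω)
    rw [Real.exp_neg, ← div_eq_mul_inv, le_div_iff₀ (Real.exp_pos _)]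
    have hB : 0 ≤ B := (Finset.sum_nonneg fun j _ => by positivity).trans (hu.sum_le ω k)
    calc ‖∑ j, u ω k j * v ω l j‖ * Real.exp (d k l)
        ≤ (∑ j, ‖u ω k j * v ω l j‖) * Real.exp (d k l) := by
          gcongr
          exact norm_sum_le _ _
      _ ≤ ∑ j, (‖u ω k j‖ * Real.exp (d k j)) * B := by
          rw [Finset.sum_mul]
          refine Finset.sum_le_sum fun j _ => ?_
          have h2 : ‖v ω l j‖ * Real.exp (d l j) ≤ B :=
            (Finset.single_le_sum (f := fun j => ‖v ω l j‖ * Real.exp (d l j))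
              (fun j _ => by positivity) (Finset.mem_univ j)).trans (hv.sum_le ω l)
          have h3 : Real.exp (d k l) ≤ Real.exp (d k j) * Real.exp (d l j) := by
            rw [← Real.exp_add, hsymm l j]
            exact Real.exp_le_exp.mpr (htri k j l)
          calc ‖u ω k j * v ω l j‖ * Real.exp (d k l)
              ≤ ‖u ω k j‖ * ‖v ω l j‖ * (Real.exp (d k j) * Real.exp (d l j)) := by
                rw [norm_mul]
                gcongr
            _ = (‖u ω k j‖ * Real.exp (d k j)) * (‖v ω l j‖ * Real.exp (d l j)) := by ring
            _ ≤ _ := by gcongr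
      _ ≤ B * B := by
          rw [← Finset.sum_mul]
          gcongr
          exact hu.sum_le ω k
  have h4 := norm_integral_le_of_norm_le
    (((integrable_etaW hβ).mul_const (B * B)).mul_const (Real.exp (-d k l)))
    (Filter.Eventually.of_forall h1)
  rw [integral_mul_const, integral_mul_const, Real.exp_neg, ← div_eq_mul_inv,
    le_div_iff₀ (Real.exp_pos _)] at h4
  exact h4

theorem integral_sum_smul_sub_sub {E : Type*} [NormedAddCommGroup E] [NormedSpace ℂ E]
    [CompleteSpace E] {f g e : ι → ι → ℝ → ℂ} (hf : ∀ k l, Integrable (f k l))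
    (hg : ∀ k l, Integrable (g k l)) (he : ∀ k l, Integrable (e k l)) (x y z : ι → ι → E) :
    ∫ ω, ∑ k, ∑ l, (f k l ω • x k l - g k l ω • y k l - e k l ω • z k l)
      = ∑ k, ∑ l, ((∫ ω, f k l ω) • x k l - (∫ ω, g k l ω) • y k l - (∫ ω, e k l ω) • z k l) := by
  have i1 := fun k l => (hf k l).smul_const (x k l)
  have i2 := fun k l => (hg k l).smul_const (y k l)
  have i3 := fun k l => (he k l).smul_const (z k l)
  have i4 : ∀ k l, Integrable fun ω => f k l ω • x k l - g k l ω • y k l - e k l ω • z k l :=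
    fun k l => ((i1 k l).sub (i2 k l)).sub (i3 k l)
  rw [integral_finsetSum _ fun k _ => integrable_finsetSum _ fun l _ => i4 k l]
  refine Finset.sum_congr rfl fun k _ => ?_
  rw [integral_finsetSum _ fun l _ => i4 k l]
  refine Finset.sum_congr rfl fun l _ => ?_
  rw [integral_sub (f := fun ω => f k l ω • x k l - g k l ω • y k l)
    ((i1 k l).sub (i2 k l)) (i3 k l), integral_sub (i1 k l) (i2 k l),
    integral_smul_const, integral_smul_const, integral_smul_const]

end coefficients

/-! ### Jump operators as linear forms and the dissipative part as a bilinear form -/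

namespace MajoranaSystem

theorem jumpFree_eq (M : MajoranaSystem n ℋ) {β c : ℝ}
    {d : Fin (2 * n) → Fin (2 * n) → ℝ}
    {h : Matrix (Fin (2 * n)) (Fin (2 * n)) ℂ} (hH : IsSelfAdjoint (M.quadratic h)) (hβ : 0 < β)
    (hT : HasExpRowBound d c (generator h)) (hc : 0 ≤ c) (hd : ∀ i j, 0 ≤ d i j)
    (j : Fin (2 * n)) (ω : ℝ) :
    M.jumpFree β (M.quadratic h) j ω
      = ∑ k, jumpCoeff β (generator h) ω k j • M.γ k := by
  have hint : Integrable fun t : ℝ =>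
      ((filterF β t : ℂ) * Complex.exp (-(Complex.I * ω * t))) •
        M.gammaFree (M.quadratic h) j t := by
    have h0 : Integrable (filterF β) := by simpa using integrable_filterF_mul_exp hβ 0
    refine h0.mono' ((continuous_filter_phase β ω).smul
      (M.continuous_gammaFree h j)).aestronglyMeasurable (Filter.Eventually.of_forall fun t => ?_)
    rw [norm_smul, norm_filter_phase]
    exact mul_le_of_le_one_right (filterF_nonneg β t) (M.norm_gammaFree_le hH j t)
  -- Conjugation by the imaginary-time exponentials is a bounded linear map, so it passes through
  -- the Bochner integral and acts on each γ_j(t) as a complex time shift.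
  have hcomm := (ContinuousLinearMap.mulLeftRight ℂ (ℋ →L[ℂ] ℋ)
    (NormedSpace.exp ((-(β / 4 : ℝ) : ℂ) • M.quadratic h))
    (NormedSpace.exp (((β / 4 : ℝ) : ℂ) • M.quadratic h))).integral_comp_comm hint
  simp only [ContinuousLinearMap.mulLeftRight_apply] at hcomm
  rw [jumpFree, mul_smul_comm, smul_mul_assoc, ← hcomm]
  have hterm : ∀ t : ℝ, NormedSpace.exp ((-(β / 4 : ℝ) : ℂ) • M.quadratic h) *
      (((filterF β t : ℂ) * Complex.exp (-(Complex.I * ω * t))) •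
        M.gammaFree (M.quadratic h) j t) * NormedSpace.exp (((β / 4 : ℝ) : ℂ) • M.quadratic h)
      = ∑ k, (((filterF β t : ℂ) * Complex.exp (-(Complex.I * ω * t))) *
        (NormedSpace.exp (((-(β / 4 : ℝ) : ℂ) + Complex.I * t) • generator h)) k j) • M.γ k := by
    intro t
    have h1 := M.exp_conj_gammaFree h (-(β / 4 : ℝ) : ℂ) j t
    rw [neg_neg] at h1
    rw [mul_smul_comm, smul_mul_assoc, h1, Finset.smul_sum]
    simp only [smul_smul]
  simp only [hterm]
  rw [integral_finsetSum _ fun k _ => (hT.integrable_jump hβ hc hd ω k j).smul_const (M.γ k),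
    Finset.smul_sum]
  refine Finset.sum_congr rfl fun k _ => ?_
  rw [integral_smul_const, smul_smul, jumpCoeff]

theorem superL_sum_mul_superR_sum (x y : Fin (2 * n) → ℋ →L[ℂ] ℋ) (a b : Fin (2 * n) → ℂ) :
    superL (∑ k, a k • x k) * superR (∑ l, b l • y l)
      = ∑ k, ∑ l, (a k * b l) • (superL (x k) * superR (y l)) := by
  ext1 X
  simp only [sum_apply, smul_apply, mul_apply_eq_comp, superL_apply, superR_apply,
    Finset.sum_mul, Finset.mul_sum, smul_mul_assoc, mul_smul_comm, Finset.smul_sum, smul_smul]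
  rw [Finset.sum_comm]
  simp only [mul_comm]

theorem superL_sum_mul_sum (x y : Fin (2 * n) → ℋ →L[ℂ] ℋ) (a b : Fin (2 * n) → ℂ) :
    superL ((∑ k, a k • x k) * ∑ l, b l • y l)
      = ∑ k, ∑ l, (a k * b l) • superL (x k * y l) := by
  ext1 X
  simp only [sum_apply, smul_apply, superL_apply,
    Finset.sum_mul, Finset.mul_sum, smul_mul_assoc, mul_smul_comm, Finset.smul_sum, smul_smul]
  rw [Finset.sum_comm]
  simp only [mul_comm]

theorem superR_sum_mul_sum (x y : Fin (2 * n) → ℋ →L[ℂ] ℋ) (a b : Fin (2 * n) → ℂ) :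
    superR ((∑ k, a k • x k) * ∑ l, b l • y l)
      = ∑ k, ∑ l, (a k * b l) • superR (x k * y l) := by
  ext1 X
  simp only [sum_apply, smul_apply, superR_apply,
    Finset.sum_mul, Finset.mul_sum, smul_mul_assoc, mul_smul_comm, Finset.smul_sum, smul_smul]
  rw [Finset.sum_comm]
  simp only [mul_comm]

theorem star_sum_γ (M : MajoranaSystem n ℋ) (a : Fin (2 * n) → ℂ) :
    star (∑ k, a k • M.γ k) = ∑ k, conj (a k) • M.γ k := by
  simp only [star_sum, star_smul, (M.isSelfAdjoint _).star_eq]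
  rfl

/-- The dissipative part of the parent Hamiltonian before third quantization is applied. -/
theorem parentDissipativeFree_eq (M : MajoranaSystem n ℋ) {β c : ℝ}
    {d : Fin (2 * n) → Fin (2 * n) → ℝ}
    {h : Matrix (Fin (2 * n)) (Fin (2 * n)) ℂ} (hH : IsSelfAdjoint (M.quadratic h)) (hβ : 0 < β)
    (hT : HasExpRowBound d c (generator h)) (hc : 0 ≤ c) (hd : ∀ i j, 0 ≤ d i j) :
    M.parentDissipativeFree β (M.quadratic h) =
      ∑ k, ∑ l,
        (etaPairing β (fun ω => jumpCoeff β (generator h) (-ω))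
            (fun ω k j => conj (jumpCoeff β (generator h) (-ω) k j)) k l •
              M.Phi (superL (M.γ k) * superR (M.γ l))
          - (1 / 2 * etaPairing β (fun ω => jumpCoeff β (generator h) (-ω))
            (jumpCoeff β (generator h)) k l) • M.Phi (superL (M.γ k * M.γ l))
          - (1 / 2 * etaPairing β (fun ω k j => conj (jumpCoeff β (generator h) ω k j))
            (fun ω k j => conj (jumpCoeff β (generator h) (-ω) k j)) k l) •
              M.Phi (superR (M.γ k * M.γ l))) := by
  have hu := hT.isBoundedFamily hβ hc hd
  have hterm : ∀ j, (∫ ω : ℝ, (etaW β ω : ℂ) •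
    (superL (M.jumpFree β (M.quadratic h) j (-ω)) *
        superR (star (M.jumpFree β (M.quadratic h) j (-ω)))
      - (1 / 2 : ℂ) • superL (M.jumpFree β (M.quadratic h) j (-ω) *
          M.jumpFree β (M.quadratic h) j ω)
      - (1 / 2 : ℂ) • superR (star (M.jumpFree β (M.quadratic h) j ω) *
          star (M.jumpFree β (M.quadratic h) j (-ω)))))
      = ∑ k, ∑ l,
        ((∫ ω, (etaW β ω : ℂ) * (jumpCoeff β (generator h) (-ω) k j *
            conj (jumpCoeff β (generator h) (-ω) l j))) • (superL (M.γ k) * superR (M.γ l))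
        - (∫ ω, (etaW β ω : ℂ) * (jumpCoeff β (generator h) (-ω) k j *
            jumpCoeff β (generator h) ω l j)) • ((1 / 2 : ℂ) • superL (M.γ k * M.γ l))
        - (∫ ω, (etaW β ω : ℂ) * (conj (jumpCoeff β (generator h) ω k j) *
            conj (jumpCoeff β (generator h) (-ω) l j))) •
              ((1 / 2 : ℂ) • superR (M.γ k * M.γ l))) := by
    intro j
    refine Eq.trans (integral_congr_ae (Filter.Eventually.of_forall fun ω => ?_))
      (integral_sum_smul_sub_sub
        (fun k l => hu.neg.integrable_mul hβ hd hu.neg.conj k l j j)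
        (fun k l => hu.neg.integrable_mul hβ hd hu k l j j)
        (fun k l => hu.conj.integrable_mul hβ hd hu.neg.conj k l j j)
        (fun k l => superL (M.γ k) * superR (M.γ l))
        (fun k l => (1 / 2 : ℂ) • superL (M.γ k * M.γ l))
        (fun k l => (1 / 2 : ℂ) • superR (M.γ k * M.γ l)))
    simp only [M.jumpFree_eq hH hβ hT hc hd, M.star_sum_γ, superL_sum_mul_superR_sum,
      superL_sum_mul_sum, superR_sum_mul_sum, Finset.smul_sum, ← Finset.sum_sub_distrib]
    refine Finset.sum_congr rfl fun k _ => Finset.sum_congr rfl fun l _ => ?_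
    module
  simp only [parentDissipativeFree, hterm]
  rw [Finset.sum_comm, map_sum]
  refine Finset.sum_congr rfl fun k _ => ?_
  rw [Finset.sum_comm, map_sum]
  refine Finset.sum_congr rfl fun l _ => ?_
  rw [Finset.sum_sub_distrib, Finset.sum_sub_distrib, ← Finset.sum_smul, ← Finset.sum_smul,
    ← Finset.sum_smul, map_sub, map_sub, map_smul, map_smul, map_smul, map_smul, map_smul,
    smul_smul, smul_smul, mul_comm _ (1 / 2 : ℂ), mul_comm _ (1 / 2 : ℂ)]
  rfl

end MajoranaSystem

namespace MajoranaSystem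

/-! ### The parity superoperator -/

/-- The product of all Majorana operators. -/
def chirality (M : MajoranaSystem n ℋ) : ℋ →L[ℂ] ℋ := M.monomial fun _ => 1

theorem chirality_mul_γ (M : MajoranaSystem n ℋ) (k : Fin (2 * n)) :
    M.chirality * M.γ k = -(M.γ k * M.chirality) := by
  have hsign : conjSign k (fun _ => 1 : Fin (2 * n) → Fin 2) = -1 := by
    have hone : ∏ i, (if i = k then (-1 : ℂ) else 1) = -1 := by simp
    have hall : ∏ _i : Fin (2 * n), (-1 : ℂ) = 1 := by simp [pow_mul]
    rw [← hone, conjSign, ← one_mul (∏ i, if i = k then (-1 : ℂ) else 1), ← hall,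
      ← Finset.prod_mul_distrib]
    refine Finset.prod_congr rfl fun i _ => ?_
    by_cases hik : i = k <;> simp [hik]
  have h := M.monomial_conj k fun _ => 1
  rw [hsign, neg_one_smul] at h
  have h2 := congrArg (M.γ k * ·) h
  rw [chirality]
  simpa [← mul_assoc, M.γ_sq] using h2

/-- The parity automorphism of `B(ℋ)`: it flips the sign of all Majorana operators. -/
def paritySuper (M : MajoranaSystem n ℋ) : (ℋ →L[ℂ] ℋ) →L[ℂ] (ℋ →L[ℂ] ℋ) :=
  superL M.chirality * superR (star M.chirality)

theorem paritySuper_apply (M : MajoranaSystem n ℋ) (X : ℋ →L[ℂ] ℋ) :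
    M.paritySuper X = M.chirality * X * star M.chirality := by
  simp [paritySuper, mul_assoc]

theorem paritySuper_mul (M : MajoranaSystem n ℋ) (X Y : ℋ →L[ℂ] ℋ) :
    M.paritySuper (X * Y) = M.paritySuper X * M.paritySuper Y := by
  have h : star M.chirality * M.chirality = 1 := (M.monomial_unitary _).1
  simp only [paritySuper_apply]
  calc M.chirality * (X * Y) * star M.chirality
      = M.chirality * X * 1 * Y * star M.chirality := by noncomm_ring
    _ = _ := by rw [← h]; noncomm_ring

theorem paritySuper_one (M : MajoranaSystem n ℋ) : M.paritySuper 1 = 1 := by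
  rw [paritySuper_apply, mul_one]
  exact (M.monomial_unitary _).2

theorem paritySuper_γ (M : MajoranaSystem n ℋ) (k : Fin (2 * n)) :
    M.paritySuper (M.γ k) = -M.γ k := by
  have h : M.chirality * star M.chirality = 1 := (M.monomial_unitary _).2
  rw [paritySuper_apply, chirality_mul_γ, neg_mul, mul_assoc, h, mul_one]

theorem paritySuper_monomial (M : MajoranaSystem n ℋ) (α : Fin (2 * n) → Fin 2) :
    M.paritySuper (M.monomial α) = (-1 : ℂ) ^ (∑ j, (α j : ℕ)) • M.monomial α := by
  have key : ∀ (m : ℕ) (x : Fin m → ℋ →L[ℂ] ℋ) (c : Fin m → ℂ),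
      (∀ j, M.paritySuper (x j) = c j • x j) →
      M.paritySuper (List.ofFn x).prod = (∏ j, c j) • (List.ofFn x).prod := by
    intro m
    induction m with
    | zero => intro x c _; simp [paritySuper_one]
    | succ m ih =>
      intro x c hx
      rw [List.ofFn_succ, List.prod_cons, paritySuper_mul, hx, Fin.prod_univ_succ,
        ih _ (fun j => c j.succ) fun j => hx j.succ, smul_mul_smul_comm]
  rw [← Finset.prod_pow_eq_pow_sum]
  refine key _ _ _ fun j => ?_
  generalize α j = a
  fin_cases a
  · simp [paritySuper_one]
  · simp [paritySuper_γ]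

/-- Averaging X with its parity image annihilates the odd monomials in its expansion and keeps the
even ones. -/
theorem mem_evenOps_of_paritySuper (M : MajoranaSystem n ℋ) {X : ℋ →L[ℂ] ℋ}
    (hX : M.paritySuper X = X) : X ∈ M.evenOps := by
  have h1 : X = (1 / 2 : ℂ) • (X + M.paritySuper X) := by
    rw [hX]; module
  have h2 := M.monomialBasis.sum_repr X
  rw [h1, ← h2, map_sum, ← Finset.sum_add_distrib]
  refine Submodule.smul_mem _ _ (Submodule.sum_mem _ fun α _ => ?_)
  rw [map_smul, monomialBasis_apply, paritySuper_monomial, ← smul_add]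
  refine Submodule.smul_mem _ _ ?_
  rcases Nat.even_or_odd (∑ j, (α j : ℕ)) with h | h
  · have hm : M.monomial α ∈ M.evenOps := Submodule.subset_span ⟨α, h, rfl⟩
    exact Submodule.add_mem _ hm (Submodule.smul_mem _ _ hm)
  · rw [h.neg_one_pow, neg_one_smul, add_neg_cancel]
    exact Submodule.zero_mem _

theorem mem_oddOps_of_paritySuper (M : MajoranaSystem n ℋ) {X : ℋ →L[ℂ] ℋ}
    (hX : M.paritySuper X = -X) : X ∈ M.oddOps := by
  have h1 : X = (1 / 2 : ℂ) • (X - M.paritySuper X) := by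
    rw [hX]; module
  have h2 := M.monomialBasis.sum_repr X
  rw [h1, ← h2, map_sum, ← Finset.sum_sub_distrib]
  refine Submodule.smul_mem _ _ (Submodule.sum_mem _ fun α _ => ?_)
  rw [map_smul, monomialBasis_apply, paritySuper_monomial, ← smul_sub]
  refine Submodule.smul_mem _ _ ?_
  rcases Nat.even_or_odd (∑ j, (α j : ℕ)) with h | h
  · rw [h.neg_one_pow, one_smul, sub_self]
    exact Submodule.zero_mem _
  · have hm : M.monomial α ∈ M.oddOps := Submodule.subset_span ⟨α, h, rfl⟩
    exact Submodule.sub_mem _ hm (Submodule.smul_mem _ _ hm)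

/-! ### Third quantization of the Majorana superoperators -/

theorem rep_apply (M : MajoranaSystem n ℋ) (𝒳 : (ℋ →L[ℂ] ℋ) →L[ℂ] (ℋ →L[ℂ] ℋ))
    (v : EnlargedSpace n) : M.rep 𝒳 v = M.phi (𝒳 (M.phi.symm v)) := rfl

theorem rep_vBasis (M : MajoranaSystem n ℋ) (𝒳 : (ℋ →L[ℂ] ℋ) →L[ℂ] (ℋ →L[ℂ] ℋ))
    (α : Fin (2 * n) → Fin 2) : M.rep 𝒳 (vBasis n α) = M.phi (𝒳 (M.monomial α)) := by
  rw [rep_apply, ← M.phi_monomial, LinearEquiv.symm_apply_apply]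

theorem rep_mul (M : MajoranaSystem n ℋ) (𝒳 𝒴 : (ℋ →L[ℂ] ℋ) →L[ℂ] (ℋ →L[ℂ] ℋ)) :
    M.rep (𝒳 * 𝒴) = M.rep 𝒳 * M.rep 𝒴 := by
  ext1 v
  simp [rep_apply]

theorem rep_add (M : MajoranaSystem n ℋ) (𝒳 𝒴 : (ℋ →L[ℂ] ℋ) →L[ℂ] (ℋ →L[ℂ] ℋ)) :
    M.rep (𝒳 + 𝒴) = M.rep 𝒳 + M.rep 𝒴 := by
  ext1 v
  simp [rep_apply]

theorem rep_neg (M : MajoranaSystem n ℋ) (𝒳 : (ℋ →L[ℂ] ℋ) →L[ℂ] (ℋ →L[ℂ] ℋ)) :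
    M.rep (-𝒳) = -M.rep 𝒳 := by
  ext1 v
  simp [rep_apply]

theorem rep_one (M : MajoranaSystem n ℋ) : M.rep 1 = 1 := by
  ext1 v
  simp [rep_apply]

theorem ext_vBasis {A B : EnlargedSpace n →L[ℂ] EnlargedSpace n}
    (h : ∀ α, A (vBasis n α) = B (vBasis n α)) : A = B :=
  ContinuousLinearMap.coe_injective ((vBasis n).ext h)

theorem parityHat_vBasis (α : Fin (2 * n) → Fin 2) :
    parityHat n (vBasis n α) = (-1 : ℂ) ^ (∑ j, (α j : ℕ)) • vBasis n α := by
  rw [parityHat, LinearMap.coe_toContinuousLinearMap', Module.Basis.constr_basis]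

theorem cHat_vBasis (M : MajoranaSystem n ℋ) (j : Fin (2 * n)) (α : Fin (2 * n) → Fin 2) :
    M.cHat j (vBasis n α) = if α j = 1 then M.phi (M.γ j * M.monomial α) else 0 := by
  rw [cHat, LinearMap.coe_toContinuousLinearMap', Module.Basis.constr_basis]

theorem cHatDag_vBasis (M : MajoranaSystem n ℋ) (j : Fin (2 * n)) (α : Fin (2 * n) → Fin 2) :
    M.cHatDag j (vBasis n α) = if α j = 0 then M.phi (M.γ j * M.monomial α) else 0 := by
  rw [cHatDag, LinearMap.coe_toContinuousLinearMap', Module.Basis.constr_basis]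

/-- The diagonal sign operator is the image of an algebra automorphism of B(ℋ), so its relations
with left and right multiplication can be checked there instead of on basis vectors. -/
theorem parityHat_eq_rep (M : MajoranaSystem n ℋ) : parityHat n = M.rep M.paritySuper := by
  refine ext_vBasis fun α => ?_
  rw [parityHat_vBasis, rep_vBasis, paritySuper_monomial, map_smul, phi_monomial]

theorem parityHat_mul_self : parityHat n * parityHat n = 1 := by
  refine ext_vBasis fun α => ?_
  rw [mul_apply_eq_comp, parityHat_vBasis, map_smul, parityHat_vBasis, smul_smul, ← mul_pow]
  simp

theorem parityHat_mul_repL (M : MajoranaSystem n ℋ) (k : Fin (2 * n)) :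
    parityHat n * M.rep (superL (M.γ k)) = -(M.rep (superL (M.γ k)) * parityHat n) := by
  rw [M.parityHat_eq_rep, ← rep_mul, ← rep_mul, ← rep_neg]
  congr 1
  ext1 X
  simp [paritySuper_mul, paritySuper_γ]

theorem parityHat_mul_repR (M : MajoranaSystem n ℋ) (k : Fin (2 * n)) :
    parityHat n * M.rep (superR (M.γ k)) = -(M.rep (superR (M.γ k)) * parityHat n) := by
  rw [M.parityHat_eq_rep, ← rep_mul, ← rep_mul, ← rep_neg]
  congr 1
  ext1 X
  simp [paritySuper_mul, paritySuper_γ]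

/-- The even Majorana mode `2 k` of the enlarged space. -/
def evenMode (k : Fin (2 * n)) : Fin (4 * n) := ⟨2 * k, by omega⟩

/-- The odd Majorana mode `2 k + 1` of the enlarged space. -/
def oddMode (k : Fin (2 * n)) : Fin (4 * n) := ⟨2 * k + 1, by omega⟩

/-- Creation and annihilation apply the same left multiplication on complementary sets of basis
vectors. -/
theorem gammaHat_evenMode (M : MajoranaSystem n ℋ) (k : Fin (2 * n)) :
    M.gammaHat (evenMode k) = M.rep (superL (M.γ k)) := by
  have hk : (⟨(evenMode k : ℕ) / 2, by omega⟩ : Fin (2 * n)) = k := by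
    ext; simp [evenMode]
  have h2 : (evenMode k : ℕ) % 2 = 0 := by simp [evenMode]
  rw [gammaHat, if_pos h2, hk]
  refine ext_vBasis fun α => ?_
  rw [add_apply, cHat_vBasis, cHatDag_vBasis, rep_vBasis, superL_apply]
  generalize M.phi _ = v
  generalize α k = a
  fin_cases a <;> simp

theorem repR_mul_parityHat (M : MajoranaSystem n ℋ) (k : Fin (2 * n)) :
    M.rep (superR (M.γ k)) * parityHat n = M.cHatDag k - M.cHat k := by
  refine ext_vBasis fun α => ?_
  have h1 : M.monomial α * M.γ k = conjSign k α • (M.γ k * M.monomial α) := by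
    have h := congrArg (M.γ k * ·) (M.monomial_conj k α)
    simpa [← mul_assoc, M.γ_sq] using h
  -- The sign from carrying γ_k across the monomial cancels the parity sign at every mode except k.
  -- What is left is + when mode k is empty and − when it is filled, as in ĉ_k† − ĉ_k.
  have h2 : (-1 : ℂ) ^ (∑ j, (α j : ℕ)) * conjSign k α = (-1) ^ (α k : ℕ) := by
    rw [← Finset.prod_pow_eq_pow_sum, conjSign, ← Finset.prod_mul_distrib,
      Finset.prod_eq_single k]
    · simp
    · intro j _ hj
      rw [if_neg hj, ← mul_pow]
      simp
    · simp
  rw [mul_apply_eq_comp, parityHat_vBasis, map_smul, rep_vBasis, superR_apply, h1, map_smul,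
    smul_smul, h2, sub_apply, cHat_vBasis, cHatDag_vBasis]
  generalize M.phi _ = v
  generalize α k = a
  fin_cases a <;> simp

theorem gammaHat_oddMode (M : MajoranaSystem n ℋ) (k : Fin (2 * n)) :
    M.gammaHat (oddMode k) = Complex.I • (M.rep (superR (M.γ k)) * parityHat n) := by
  have hk : (⟨(oddMode k : ℕ) / 2, by omega⟩ : Fin (2 * n)) = k := by
    ext; simp only [oddMode]; omega
  have h2 : ¬ (oddMode k : ℕ) % 2 = 0 := by simp only [oddMode]; omega
  rw [gammaHat, if_neg h2, hk, repR_mul_parityHat]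

theorem I_smul_mul_I_smul {A : Type*} [Ring A] [Algebra ℂ A] {x y p : A} (hp : p * p = 1)
    (hpy : p * y = -(y * p)) : (Complex.I • (x * p)) * (Complex.I • (y * p)) = x * y := by
  rw [smul_mul_smul_comm, Complex.I_mul_I, neg_one_smul]
  calc -(x * p * (y * p)) = -(x * (p * y) * p) := by noncomm_ring
    _ = x * y * (p * p) := by rw [hpy]; noncomm_ring
    _ = x * y := by rw [hp, mul_one]

theorem mul_I_smul_add_I_smul_mul {A : Type*} [Ring A] [Algebra ℂ A] {x y p : A}
    (hpx : p * x = -(x * p)) (hxy : x * y = y * x) :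
    x * (Complex.I • (y * p)) + (Complex.I • (y * p)) * x = 0 := by
  rw [mul_smul_comm, smul_mul_assoc, ← smul_add, mul_assoc y p, hpx, mul_neg, ← mul_assoc,
    ← mul_assoc, hxy, add_neg_cancel, smul_zero]

/-- The order is reversed because right multiplication is antimultiplicative. The two factors i give
−1, which cancels the sign from moving one parity operator past a right multiplication. -/
theorem gammaHat_oddMode_mul (M : MajoranaSystem n ℋ) (k l : Fin (2 * n)) :
    M.gammaHat (oddMode k) * M.gammaHat (oddMode l) = M.rep (superR (M.γ l * M.γ k)) := by
  have h1 : superR (M.γ l * M.γ k) = superR (M.γ k) * superR (M.γ l) := by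
    ext1 X
    simp [mul_assoc]
  have h2 := M.parityHat_mul_repR l
  rw [gammaHat_oddMode, gammaHat_oddMode, h1, rep_mul]
  exact I_smul_mul_I_smul parityHat_mul_self h2

theorem gammaHat_evenMode_mul (M : MajoranaSystem n ℋ) (k l : Fin (2 * n)) :
    M.gammaHat (evenMode k) * M.gammaHat (evenMode l) = M.rep (superL (M.γ k * M.γ l)) := by
  have h1 : superL (M.γ k * M.γ l) = superL (M.γ k) * superL (M.γ l) := by
    ext1 X
    simp [mul_assoc]
  rw [gammaHat_evenMode, gammaHat_evenMode, h1, rep_mul]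

theorem evenMode_injective : Function.Injective (evenMode (n := n)) := by
  intro k l h
  simp only [evenMode, Fin.ext_iff] at h ⊢
  omega

theorem oddMode_injective : Function.Injective (oddMode (n := n)) := by
  intro k l h
  simp only [oddMode, Fin.ext_iff] at h ⊢
  omega

theorem evenMode_ne_oddMode (k l : Fin (2 * n)) : evenMode k ≠ oddMode l := by
  simp only [evenMode, oddMode, ne_eq, Fin.ext_iff]
  omega

/-- The single-particle mode underlying a Majorana mode of the enlarged space. -/
def halfMode (p : Fin (4 * n)) : Fin (2 * n) := ⟨p / 2, by omega⟩

theorem eq_evenMode_or_oddMode (p : Fin (4 * n)) :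
    p = evenMode (halfMode p) ∨ p = oddMode (halfMode p) := by
  simp only [evenMode, oddMode, halfMode, Fin.ext_iff]
  omega

theorem gammaHat_even_odd (M : MajoranaSystem n ℋ) (k l : Fin (2 * n)) :
    M.gammaHat (evenMode k) * M.gammaHat (oddMode l)
      + M.gammaHat (oddMode l) * M.gammaHat (evenMode k) = 0 := by
  have h1 : M.rep (superL (M.γ k)) * M.rep (superR (M.γ l))
      = M.rep (superR (M.γ l)) * M.rep (superL (M.γ k)) := by
    rw [← rep_mul, ← rep_mul]
    rfl
  rw [gammaHat_evenMode, gammaHat_oddMode]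
  exact mul_I_smul_add_I_smul_mul (M.parityHat_mul_repL k) h1

/-- The Majorana operators of the enlarged space satisfy the canonical anticommutation
relations. -/
theorem gammaHat_anticomm (M : MajoranaSystem n ℋ) (p q : Fin (4 * n)) :
    M.gammaHat p * M.gammaHat q + M.gammaHat q * M.gammaHat p = if p = q then 2 else 0 := by
  have hL : M.rep (superL (2 : ℋ →L[ℂ] ℋ)) = 2 := by
    have h : superL (2 : ℋ →L[ℂ] ℋ) = 1 + 1 := by ext1 X; simp [two_mul]
    rw [h, rep_add, rep_one, one_add_one_eq_two]
  have hR : M.rep (superR (2 : ℋ →L[ℂ] ℋ)) = 2 := by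
    have h : superR (2 : ℋ →L[ℂ] ℋ) = 1 + 1 := by ext1 X; simp [mul_two]
    rw [h, rep_add, rep_one, one_add_one_eq_two]
  have hL0 : M.rep (superL (0 : ℋ →L[ℂ] ℋ)) = 0 := by ext1 v; simp [rep_apply]
  have hR0 : M.rep (superR (0 : ℋ →L[ℂ] ℋ)) = 0 := by ext1 v; simp [rep_apply]
  have hLa : ∀ x y : ℋ →L[ℂ] ℋ, superL x + superL y = superL (x + y) :=
    fun x y => (map_add _ x y).symm
  have hRa : ∀ x y : ℋ →L[ℂ] ℋ, superR x + superR y = superR (x + y) :=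
    fun x y => (map_add _ x y).symm
  rcases eq_evenMode_or_oddMode p with hp | hp <;> rcases eq_evenMode_or_oddMode q with hq | hq <;>
    rw [hp, hq]
  · rw [gammaHat_evenMode_mul, gammaHat_evenMode_mul, ← rep_add, hLa, M.anticomm]
    simp only [evenMode_injective.eq_iff]
    split_ifs
    · exact hL
    · exact hL0
  · rw [gammaHat_even_odd, if_neg (evenMode_ne_oddMode _ _)]
  · rw [add_comm, gammaHat_even_odd, if_neg (evenMode_ne_oddMode _ _).symm]
  · rw [gammaHat_oddMode_mul, gammaHat_oddMode_mul, ← rep_add, hRa, M.anticomm]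
    simp only [oddMode_injective.eq_iff, eq_comm (a := halfMode q)]
    split_ifs
    · exact hR
    · exact hR0

/-- The parity inserted by Φ for an odd right factor is the one contained in the odd mode; without
it the image would not be quadratic in this form. The scalar −i undoes the i in the mode. -/
theorem Phi_superL_γ_superR_γ (M : MajoranaSystem n ℋ) (k l : Fin (2 * n)) :
    M.Phi (superL (M.γ k) * superR (M.γ l))
      = (-Complex.I) • (M.gammaHat (evenMode k) * M.gammaHat (oddMode l)) := by
  rw [M.Phi_odd _ _ (M.mem_oddOps_of_paritySuper (M.paritySuper_γ l)), gammaHat_evenMode,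
    gammaHat_oddMode, mul_smul_comm, smul_smul, neg_mul, Complex.I_mul_I, neg_neg, one_smul]

theorem Phi_superL_γ_mul_γ (M : MajoranaSystem n ℋ) (k l : Fin (2 * n)) :
    M.Phi (superL (M.γ k * M.γ l)) = M.gammaHat (evenMode k) * M.gammaHat (evenMode l) := by
  have h1 : superR (1 : ℋ →L[ℂ] ℋ) = 1 := by ext1 X; simp
  have h := M.Phi_even (M.γ k * M.γ l) 1 (M.mem_evenOps_of_paritySuper M.paritySuper_one)
  rwa [h1, mul_one, rep_one, mul_one, ← gammaHat_evenMode_mul] at h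

theorem Phi_superR_γ_mul_γ (M : MajoranaSystem n ℋ) (k l : Fin (2 * n)) :
    M.Phi (superR (M.γ k * M.γ l)) = M.gammaHat (oddMode l) * M.gammaHat (oddMode k) := by
  have h1 : superL (1 : ℋ →L[ℂ] ℋ) = 1 := by ext1 X; simp
  have h := M.Phi_even 1 (M.γ k * M.γ l) (M.mem_evenOps_of_paritySuper (by
    rw [paritySuper_mul, paritySuper_γ, paritySuper_γ, neg_mul_neg]))
  rwa [h1, one_mul, rep_one, one_mul, ← gammaHat_oddMode_mul] at h

end MajoranaSystem

/-! ### Quadratic forms on the enlarged space -/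

theorem sum_modes {n : ℕ} {E : Type*} [AddCommMonoid E] (F : Fin (4 * n) → E) :
    ∑ p, F p = ∑ k : Fin (2 * n), (F (MajoranaSystem.evenMode k) + F (MajoranaSystem.oddMode k)) := by
  let e : Fin (2 * n) × Fin 2 ≃ Fin (4 * n) :=
    { toFun := fun x => ⟨2 * x.1 + x.2, by omega⟩
      invFun := fun p => (MajoranaSystem.halfMode p, ⟨p % 2, Nat.mod_lt _ two_pos⟩)
      left_inv := fun x => by
        ext <;> simp only [MajoranaSystem.halfMode] <;> omega
      right_inv := fun p => by
        ext; simp only [MajoranaSystem.halfMode]; omega }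
  rw [← e.sum_comp, Fintype.sum_prod_type]
  simp only [Fin.sum_univ_two]
  rfl

/-- Off the diagonal the symmetric part of m cancels by anticommutation. On the diagonal every
square is 1, so only the trace of m matters and it can be spread evenly. -/
theorem sum_antisymm_eq {A ι : Type*} [Ring A] [Algebra ℂ A] [Fintype ι] [DecidableEq ι]
    (g : ι → A) (hg : ∀ p q, g p * g q + g q * g p = if p = q then 2 else 0)
    (m : Matrix ι ι ℂ) :
    ∑ p, ∑ q, m p q • (g p * g q)
      = ∑ p, ∑ q, (if p = q then (∑ r, m r r) / Fintype.card ι else (m p q - m q p) / 2) •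
        (g p * g q) := by
  -- The averaged diagonal divides by the number of modes, so the empty case is set apart.
  rcases isEmpty_or_nonempty ι with hι | hι
  · simp
  have hsq : ∀ p, g p * g p = 1 := by
    intro p
    have h := hg p p
    rw [if_pos rfl] at h
    have h2 : (2 : ℂ) • (g p * g p) = (2 : ℂ) • (1 : A) := by
      rw [two_smul, two_smul, h, one_add_one_eq_two]
    exact smul_right_injective A (two_ne_zero (α := ℂ)) h2
  have h1 : ∑ p, ∑ q, m p q • (g p * g q)
      = (1 / 2 : ℂ) • ∑ p, ∑ q, (m p q • (g p * g q) + m q p • (g q * g p)) := by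
    simp only [Finset.sum_add_distrib]
    rw [Finset.sum_comm (f := fun p q => m q p • (g q * g p))]
    module
  have h2 : ∀ p q, m p q • (g p * g q) + m q p • (g q * g p)
      = (m p q - m q p) • (g p * g q) + if p = q then (2 * m p p) • (1 : A) else 0 := by
    intro p q
    have h3 : g q * g p = (if p = q then 2 else 0) - g p * g q := by
      rw [← hg p q]; abel
    rw [h3]
    split_ifs with h4
    · subst h4
      rw [hsq, ← one_add_one_eq_two]
      module
    · module
  have h5 : ∀ p q, (if p = q then (∑ r, m r r) / Fintype.card ι else (m p q - m q p) / 2) •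
      (g p * g q) = (1 / 2 : ℂ) • (m p q - m q p) • (g p * g q) +
        if p = q then ((∑ r, m r r) / Fintype.card ι) • (1 : A) else 0 := by
    intro p q
    split_ifs with h4
    · subst h4
      rw [hsq]
      module
    · module
  rw [h1]
  simp only [h2, h5, Finset.sum_add_distrib, Finset.sum_ite_eq, Finset.mem_univ, if_true, smul_add,
    Finset.smul_sum]
  congr 1
  rw [← Finset.smul_sum, ← Finset.sum_smul, Finset.sum_const, Finset.card_univ, ← Finset.mul_sum,
    smul_smul, ← Nat.cast_smul_eq_nsmul ℂ, smul_smul]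
  congr 1
  have h6 : (Fintype.card ι : ℂ) ≠ 0 := Nat.cast_ne_zero.mpr Fintype.card_ne_zero
  field_simp

theorem sum_even_odd_parts {A ι : Type*} [Ring A] [Algebra ℂ A] [Fintype ι] (X Y Z : Matrix ι ι ℂ)
    (x y : ι → A) :
    ∑ k, ∑ l, (X k l • (-Complex.I) • (x k * y l) - (1 / 2 * Y k l) • (x k * x l)
        - (1 / 2 * Z k l) • (y l * y k))
      = ∑ k, (∑ l, ((-(1 / 2) * Y k l) • (x k * x l) + (-Complex.I * X k l) • (x k * y l))
        + ∑ l, ((0 : ℂ) • (y k * x l) + (-(1 / 2) * Z l k) • (y k * y l))) := by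
  simp only [zero_smul, zero_add]
  rw [Finset.sum_add_distrib, Finset.sum_comm (f := fun k l => (-(1 / 2) * Z l k) • (y k * y l)),
    ← Finset.sum_add_distrib]
  refine Finset.sum_congr rfl fun k _ => ?_
  rw [← Finset.sum_add_distrib]
  refine Finset.sum_congr rfl fun l _ => ?_
  module

theorem card_block_le {n : ℕ} (x : Fin n) :
    Fintype.card {p : Fin (4 * n) // modeSite' p = x} ≤ 4 := by
  have h := Fintype.card_le_of_injective
    (fun p : {p : Fin (4 * n) // modeSite' p = x} => (⟨p.1 % 4, Nat.mod_lt _ four_pos⟩ : Fin 4))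
    (by
      rintro ⟨p, hp⟩ ⟨q, hq⟩ h
      simp only [modeSite', Fin.ext_iff] at hp hq h
      exact Subtype.ext (Fin.ext (by dsimp only; omega)))
  simpa using h

/-- Crude, but harmless for blocks of bounded size. -/
theorem matrixOpNorm_le {p q : Type*} [Fintype p] [Fintype q] [DecidableEq q] (A : Matrix p q ℂ)
    {b : ℝ} (hb : 0 ≤ b) (hA : ∀ i j, ‖A i j‖ ≤ b) :
    matrixOpNorm A ≤ Fintype.card p * Fintype.card q * b := by
  refine ContinuousLinearMap.opNorm_le_bound _ (by positivity) fun v => ?_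
  rw [LinearMap.coe_toContinuousLinearMap']
  have h1 : ∀ i, ‖(Matrix.toEuclideanLin A v) i‖ ≤ Fintype.card q * b * ‖v‖ := by
    intro i
    have h2 : (Matrix.toEuclideanLin A v) i = ∑ j, A i j * v j := rfl
    rw [h2]
    refine (norm_sum_le_of_le _ (n := fun _ => b * ‖v‖) fun j _ => ?_).trans_eq ?_
    · rw [norm_mul]
      exact mul_le_mul (hA i j) (PiLp.norm_apply_le v j) (norm_nonneg _) hb
    · rw [Finset.sum_const, Finset.card_univ, nsmul_eq_mul, mul_assoc]
  have h3 : ‖Matrix.toEuclideanLin A v‖ ≤ ∑ i, ‖(Matrix.toEuclideanLin A v) i‖ := by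
    rw [EuclideanSpace.norm_eq]
    refine Real.sqrt_le_iff.mpr ⟨Finset.sum_nonneg fun i _ => norm_nonneg _, ?_⟩
    exact Finset.sum_sq_le_sq_sum_of_nonneg fun i _ => norm_nonneg _
  refine h3.trans ((Finset.sum_le_sum fun i _ => h1 i).trans_eq ?_)
  rw [Finset.sum_const, Finset.card_univ, nsmul_eq_mul]
  ring

namespace MajoranaSystem

/-- Operators that are quadratic in the Majorana operators of the enlarged space, with
exponentially decaying coefficients. -/
theorem exists_coefficientMatrix (M : MajoranaSystem n ℋ) {D : ℕ} (site : Fin n ↪ (Fin D → ℤ))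
    {b : ℝ} (hb : 0 ≤ b) (m : Matrix (Fin (4 * n)) (Fin (4 * n)) ℂ)
    (hm : ∀ p q, ‖m p q‖
      ≤ b * Real.exp (-latticeDist (site (modeSite' p)) (site (modeSite' q)))) :
    ∃ m', M.IsCoefficientMatrix m' (∑ p, ∑ q, m p q • (M.gammaHat p * M.gammaHat q)) ∧
      HasBlockDecay site modeSite' (16 * b) 1 m' := by
  refine ⟨fun p q => if p = q then (∑ r, m r r) / Fintype.card (Fin (4 * n))
    else (m p q - m q p) / 2, ⟨sum_antisymm_eq M.gammaHat M.gammaHat_anticomm m, ?_, ?_⟩, ?_⟩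
  · intro p q hpq
    simp only [if_neg hpq, if_neg (Ne.symm hpq)]
    ring
  · intro p q
    simp only [if_true]
  · have hentry : ∀ p q, ‖(if p = q then (∑ r, m r r) / Fintype.card (Fin (4 * n))
        else (m p q - m q p) / 2 : ℂ)‖
        ≤ b * Real.exp (-latticeDist (site (modeSite' p)) (site (modeSite' q))) := by
      intro p q
      split_ifs with hpq
      · subst hpq
        -- A diagonal entry is now a mean of old ones, each at distance zero and hence bounded by b,
        -- so the bound does not depend on n.
        have hpos : (0 : ℝ) < Fintype.card (Fin (4 * n)) :=
          Nat.cast_pos.mpr (Fintype.card_pos_iff.mpr ⟨p⟩)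
        rw [latticeDist_self, neg_zero, Real.exp_zero, mul_one, norm_div, Complex.norm_natCast,
          div_le_iff₀ hpos]
        refine (norm_sum_le_of_le _ (n := fun _ => b) fun r _ => ?_).trans_eq ?_
        · simpa [latticeDist_self] using hm r r
        · rw [Finset.sum_const, Finset.card_univ, nsmul_eq_mul, mul_comm]
      · have h1 := hm p q
        have h2 := hm q p
        rw [latticeDist_comm] at h2
        rw [norm_div, Complex.norm_two, div_le_iff₀ two_pos]
        refine (norm_sub_le _ _).trans ?_
        linarith
    intro x y
    have hx := card_block_le x
    have hy := card_block_le y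
    have hB : 0 ≤ b * Real.exp (-latticeDist (site x) (site y)) := by positivity
    refine (matrixOpNorm_le _ hB fun i j => ?_).trans ?_
    · have h := hentry i.1 j.1
      rwa [i.2, j.2] at h
    · rw [neg_one_mul, show (16 : ℝ) * b = 4 * 4 * b by ring, mul_assoc (4 * 4 : ℝ)]
      refine mul_le_mul_of_nonneg_right ?_ hB
      have hx' : (Fintype.card {p : Fin (4 * n) // modeSite' p = x} : ℝ) ≤ 4 := by exact_mod_cast hx
      have hy' : (Fintype.card {p : Fin (4 * n) // modeSite' p = y} : ℝ) ≤ 4 := by exact_mod_cast hy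
      gcongr

/-- The coefficient matrix assembled from its even-odd, even-even and odd-odd parts. -/
def assembleCoeff (X Y Z : Matrix (Fin (2 * n)) (Fin (2 * n)) ℂ) :
    Matrix (Fin (4 * n)) (Fin (4 * n)) ℂ := fun p q =>
  if (p : ℕ) % 2 = 0 then
    if (q : ℕ) % 2 = 0 then -(1 / 2) * Y (halfMode p) (halfMode q)
    else -Complex.I * X (halfMode p) (halfMode q)
  else if (q : ℕ) % 2 = 0 then 0 else -(1 / 2) * Z (halfMode q) (halfMode p)

theorem sum_assembleCoeff (M : MajoranaSystem n ℋ)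
    (X Y Z : Matrix (Fin (2 * n)) (Fin (2 * n)) ℂ) :
    ∑ k, ∑ l, (X k l • M.Phi (superL (M.γ k) * superR (M.γ l))
        - (1 / 2 * Y k l) • M.Phi (superL (M.γ k * M.γ l))
        - (1 / 2 * Z k l) • M.Phi (superR (M.γ k * M.γ l)))
      = ∑ p, ∑ q, assembleCoeff X Y Z p q • (M.gammaHat p * M.gammaHat q) := by
  have he : ∀ k : Fin (2 * n), (evenMode k : ℕ) % 2 = 0 := fun k => by simp [evenMode]
  have ho : ∀ k : Fin (2 * n), (oddMode k : ℕ) % 2 ≠ 0 := fun k => by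
    simp only [oddMode]; omega
  have hhe : ∀ k : Fin (2 * n), halfMode (evenMode k) = k := fun k => by
    simp only [halfMode, evenMode, Fin.ext_iff]; omega
  have hho : ∀ k : Fin (2 * n), halfMode (oddMode k) = k := fun k => by
    simp only [halfMode, oddMode, Fin.ext_iff]; omega
  simp only [sum_modes, assembleCoeff, he, ho, hhe, hho, if_true, if_false,
    Phi_superL_γ_superR_γ, Phi_superL_γ_mul_γ, Phi_superR_γ_mul_γ]
  exact sum_even_odd_parts X Y Z _ _

/-- F is asked to be symmetric because the odd-odd part enters transposed. -/
theorem norm_assembleCoeff_le {X Y Z : Matrix (Fin (2 * n)) (Fin (2 * n)) ℂ}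
    {F : Fin (2 * n) → Fin (2 * n) → ℝ} (hF : ∀ k l, F k l = F l k)
    (hX : ∀ k l, ‖X k l‖ ≤ F k l) (hY : ∀ k l, ‖Y k l‖ ≤ F k l) (hZ : ∀ k l, ‖Z k l‖ ≤ F k l)
    (p q : Fin (4 * n)) : ‖assembleCoeff X Y Z p q‖ ≤ F (halfMode p) (halfMode q) := by
  have h0 : ∀ k l, 0 ≤ F k l := fun k l => (norm_nonneg _).trans (hX k l)
  have hhalf : ‖-(1 / 2 : ℂ)‖ ≤ 1 := by norm_num
  rw [assembleCoeff]
  split_ifs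
  · rw [norm_mul]
    exact (mul_le_of_le_one_left (norm_nonneg _) hhalf).trans (hY _ _)
  · rw [norm_mul, norm_neg, Complex.norm_I, one_mul]
    exact hX _ _
  · rw [norm_zero]
    exact h0 _ _
  · rw [norm_mul, hF]
    exact (mul_le_of_le_one_left (norm_nonneg _) hhalf).trans (hZ _ _)

end MajoranaSystem

/-! ### The decay estimate with explicit constants -/

theorem parentFree_decay {n D : ℕ} {β r₀ : ℝ} (hβ : 0 < β) (site : Fin n ↪ (Fin D → ℤ))
    {ℋ : Type*} [NormedAddCommGroup ℋ] [InnerProductSpace ℂ ℋ] [CompleteSpace ℋ]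
    [FiniteDimensional ℂ ℋ] (M : MajoranaSystem n ℋ)
    (h : Matrix (Fin (2 * n)) (Fin (2 * n)) ℂ) (hH : IsSelfAdjoint (M.quadratic h))
    (hloc : M.IsGeometricallyLocal site 1 r₀ (M.quadratic h)) :
    ∃ m : Matrix (Fin (4 * n)) (Fin (4 * n)) ℂ,
      M.IsCoefficientMatrix m (M.parentFree β (M.quadratic h)) ∧
      HasBlockDecay site modeSite' (16 * ((∫ ω, etaW β ω) *
        (jumpBound β (generatorBound D r₀) * jumpBound β (generatorBound D r₀)))) 1 m := by
  let d : Fin (2 * n) → Fin (2 * n) → ℝ := fun k l =>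
    latticeDist (site (modeSite k)) (site (modeSite l))
  have hd : ∀ i j, 0 ≤ d i j := fun i j => latticeDist_nonneg _ _
  have hsymm : ∀ i j, d i j = d j i := fun i j => latticeDist_comm _ _
  have htri : ∀ i j k, d i k ≤ d i j + d j k := fun i j k => latticeDist_triangle _ _ _
  have hc : 0 ≤ generatorBound D r₀ := by
    unfold generatorBound
    positivity
  have hT : HasExpRowBound d (generatorBound D r₀) (MajoranaSystem.generator h) :=
    sum_norm_exp_le d (fun i => latticeDist_self _) htri (M.sum_norm_generator_le site h hloc)
  have hu := hT.isBoundedFamily hβ hc hd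
  have hη : 0 ≤ ∫ ω, etaW β ω := integral_nonneg fun ω => (Real.exp_pos _).le
  rw [MajoranaSystem.parentFree, M.parentCoherentFree_eq_zero β h hH, zero_add,
    M.parentDissipativeFree_eq hH hβ hT hc hd, M.sum_assembleCoeff]
  refine M.exists_coefficientMatrix site (mul_nonneg hη (mul_self_nonneg _)) _ fun p q => ?_
  have hsite : ∀ p : Fin (4 * n), modeSite (MajoranaSystem.halfMode p) = modeSite' p := fun p => by
    simp only [modeSite, modeSite', MajoranaSystem.halfMode, Fin.ext_iff]
    omega
  rw [← hsite, ← hsite]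
  refine MajoranaSystem.norm_assembleCoeff_le (F := fun k l => (∫ ω, etaW β ω) *
    (jumpBound β (generatorBound D r₀) * jumpBound β (generatorBound D r₀)) * Real.exp (-d k l))
    (fun k l => by rw [hsymm]) ?_ ?_ ?_ p q
  · exact norm_etaPairing_le hβ hd hsymm htri hu.neg hu.neg.conj
  · exact norm_etaPairing_le hβ hd hsymm htri hu.neg hu
  · exact norm_etaPairing_le hβ hd hsymm htri hu.conj hu.neg.conj

end FreeParent

end

theorem mainTheorem8 (β r₀ : ℝ) (hβ : 0 < β) (hr₀ : 0 < r₀) (D : ℕ) (hD : 0 < D) :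
    ∃ K ν : ℝ, 0 < K ∧ 0 < ν ∧
      ∀ (n : ℕ) (site : Fin n ↪ (Fin D → ℤ))
        (ℋ : Type*) [NormedAddCommGroup ℋ] [InnerProductSpace ℂ ℋ] [CompleteSpace ℋ]
        [FiniteDimensional ℂ ℋ] (M : FreeParent.MajoranaSystem n ℋ)
        (h : Matrix (Fin (2 * n)) (Fin (2 * n)) ℂ),
        IsSelfAdjoint (M.quadratic h) →
        M.IsGeometricallyLocal site 1 r₀ (M.quadratic h) →
        ∃ m : Matrix (Fin (4 * n)) (Fin (4 * n)) ℂ,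
          M.IsCoefficientMatrix m (M.parentFree β (M.quadratic h)) ∧
          FreeParent.HasBlockDecay site FreeParent.modeSite' K ν m := by
  have hη : 0 ≤ ∫ ω, FreeParent.etaW β ω := integral_nonneg fun ω => (Real.exp_pos _).le
  -- The +1 only makes K strictly positive. The rate is ν = 1, the rate of the weight e^d used
  -- throughout; the interaction range r₀ enters only through K.
  refine ⟨16 * ((∫ ω, FreeParent.etaW β ω) *
    (FreeParent.jumpBound β (FreeParent.generatorBound D r₀) *
      FreeParent.jumpBound β (FreeParent.generatorBound D r₀))) + 1, 1,
    add_pos_of_nonneg_of_pos (mul_nonneg (by norm_num) (mul_nonneg hη (mul_self_nonneg _)))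
      one_pos, one_pos, fun n site ℋ _ _ _ _ M h hH hloc => ?_⟩
  obtain ⟨m, hm, hdecay⟩ := FreeParent.parentFree_decay hβ site M h hH hloc
  refine ⟨m, hm, fun x y => (hdecay x y).trans ?_⟩
  gcongr
  linarith
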